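/- **Corollary 4.10.** Let $d\ge 1$, let $\|\cdot\|$ be an arbitrary norm on $\mathbb R^d$, let $r>0$, and let $P$ be a Borel probability measure on $\mathbb R^d$ with Borel density $h:\mathbb R^d\to\mathbb R$ with respect to Lebesgue measure such that $\int\|x\|^{r+\delta}\,dP(x)<\infty$ for some $\delta>0$, and such that $h$ is bounded away from $0$ on bounded sets: for every $\rho>0$ there is $c_\rho>0$ with $h(x)\ge c_\rho$ whenever $\|x\|\le\rho$. For a finite set $\alpha\subset\mathbb R^d$ put $d(x,\alpha)=\min_{b\in\alpha}\|x-b\|$ (with $d(x,\emptyset)=\infty$) and, for $a\in\alpha$, $$W(a|\alpha)=\{x:\|x-a\|=d(x,\alpha)\},\qquad W_0(a|\alpha)=\{x:\|x-a\|<d(x,\alpha\setminus\{a\})\}.$$ A set $\alpha$ with at most $n$ points is called $n$-optimal if $\int d(x,\alpha)^r\,dP(x)=\inf\{\int d(x,\beta)^r\,dP(x):\operatorname{card}\beta\le n\}$. Let $B(x,\varepsilon)$ be the open ball. Let $c_{21}>0$. There are constants $c_{22},c_{23},c_{24},c_{25}>0$, depending only on $d$, $\|\cdot\|$, $r$, $P$,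 $h$ and $c_{21}$, such that the following holds. Let $(\alpha_n)_{n\ge1}$ be any sequence of $n$-optimal sets $\alpha_n$ satisfying the sharpened micro-macro inequality $$\forall K\subset\mathbb R^d\text{ compact}\ \ \exists n_K\ \ \forall n\ge n_K\ \ \forall x\in K:\qquad d(x,\alpha_n)\le c_{21}\,n^{-1/d}\,h(x)^{-\frac1{r+d}}. \tag{51}$$ Let $x\in\mathbb R^d$ and, for every $n\ge 1$, let $a_{n,x}\in\alpha_n$ with $x\in W(a_{n,x}|\alpha_n)$. Then $$\limsup_{n\to\infty}\, n\,P(W(a_{n,x}|\alpha_n))\le c_{22}\Big(\limsup_{y\to x}h(y)\Big)^{\frac r{r+d}},$$ $$\limsup_{n\to\infty}\, n^{1+\frac rd}\int_{W(a_{n,x}|\alpha_n)}\|y-a_{n,x}\|^r\,dP(y)\le c_{23}\Big(1+\log\lim_{\varepsilon\downarrow0}\frac{\sup h(B(x,\varepsilon))}{\inf h(B(x,\varepsilon))}\Big),$$ $$\liminf_{n\to\infty}\, n\,P(W_0(a_{n,x}|\alpha_n))\ge c_{24}\Big(\liminf_{y\to x}h(y)\Big)^{\frac r{r+d}},$$ $$\liminf_{n\to\infty}\,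 n^{1+\frac rd}\int_{W_0(a_{n,x}|\alpha_n)}\|y-a_{n,x}\|^r\,dP(y)\ge c_{25}\Big(\lim_{\varepsilon\downarrow0}\frac{\inf h(B(x,\varepsilon))}{\sup h(B(x,\varepsilon))}\Big)^{\max(1,r)},$$ where both limits as $\varepsilon\downarrow0$ exist in $[0,\infty]$. Here $\limsup_{y\to x}$ and $\liminf_{y\to x}$ are taken over $y\ne x$, all quantities are read in $[0,\infty]$, and $\log\infty=\infty$, $c/\infty=0$ for finite $c$. Moreover, if $h$ is continuous, then for every $x\in\mathbb R^d$ $$\limsup_{y\to x}h(y)=h(x)=\liminf_{y\to x}h(y)\quad\text{and}\quad \lim_{\varepsilon\downarrow0}\frac{\sup h(B(x,\varepsilon))}{\inf h(B(x,\varepsilon))}=\lim_{\varepsilon\downarrow0}\frac{\inf h(B(x,\varepsilon))}{\sup h(B(x,\varepsilon))}=1.$$ -/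

import Mathlib

open Set Filter Topology MeasureTheory
open scoped ENNReal

namespace Quantization

/-- `d(x, S)`, the distance of a point to a set, with values in `[0, ∞]` (so that the distance to
the empty set is `∞`), raised to the power `r` and integrated against `P`. -/
noncomputable def distortion {E : Type*} [NormedAddCommGroup E] [MeasurableSpace E]
    (P : Measure E) (r : ℝ) (S : Set E) : ℝ≥0∞ :=
  ∫⁻ x, Metric.infEDist x S ^ r ∂P

/-- The `r`-th power `e_{n,r}^r` of the `n`-th level `L^r(P)`-quantization error:
the infimum of `∫ d(x, α)^r dP(x)` over all `α` with at most `n` points. -/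
noncomputable def errorPow {E : Type*} [NormedAddCommGroup E] [MeasurableSpace E]
    (P : Measure E) (r : ℝ) (n : ℕ) : ℝ≥0∞ :=
  ⨅ (α : Finset E) (_ : α.card ≤ n), distortion P r (α : Set E)

/-- `α` is an `n`-optimal codebook of order `r` for `P`. -/
def IsOptimalCodebook {E : Type*} [NormedAddCommGroup E] [MeasurableSpace E]
    (P : Measure E) (r : ℝ) (n : ℕ) (α : Finset E) : Prop :=
  α.card ≤ n ∧ distortion P r (α : Set E) = errorPow P r n

/-- The (closed) Voronoi cell `W(a | α) = {x | ‖x - a‖ = d(x, α)}`. -/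
def voronoiCell {E : Type*} [NormedAddCommGroup E] (a : E) (α : Finset E) : Set E :=
  {x | edist x a = Metric.infEDist x (α : Set E)}

/-- The open Voronoi cell `W₀(a | α) = {x | ‖x - a‖ < d(x, α \ {a})}`. -/
def openVoronoiCell {E : Type*} [NormedAddCommGroup E] (a : E) (α : Finset E) : Set E :=
  {x | edist x a < Metric.infEDist x ((α : Set E) \ {a})}

/-- The local inertia `∫_S ‖y - a‖^r dP(y)` of `P` on the set `S` about the point `a`. -/
noncomputable def inertia {E : Type*} [NormedAddCommGroup E] [MeasurableSpace E]
    (P : Measure E) (r : ℝ) (S : Set E) (a : E) : ℝ≥0∞ :=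
  ∫⁻ y in S, edist y a ^ r ∂P

/-- The function `h` is bounded away from `0` on bounded sets. -/
def BoundedBelowOnBalls {E : Type*} [NormedAddCommGroup E] (h : E → ℝ) : Prop :=
  ∀ ρ : ℝ, 0 < ρ → ∃ c : ℝ, 0 < c ∧ ∀ x ∈ Metric.closedBall (0 : E) ρ, c ≤ h x

/-- The sharpened micro-macro inequality with constant `c`, for the positive density `h` and the
sequence of codebooks `α`: on every compact set `K`, for all large `n`,
`d(x, α_n) ≤ c n^{-1/d} h(x)^{-1/(r+d)}`. -/
def SharpMicroMacro {E : Type*} [NormedAddCommGroup E]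
    (h : E → ℝ) (d : ℕ) (r : ℝ) (α : ℕ → Finset E) (c : ℝ) : Prop :=
  ∀ K : Set E, IsCompact K → ∃ nK : ℕ, ∀ n : ℕ, nK ≤ n → ∀ x ∈ K,
    Metric.infEDist x (α n : Set E) ≤
      ENNReal.ofReal (c * (n : ℝ) ^ (-(1 / (d : ℝ))) * h x ^ (-(1 / (r + (d : ℝ)))))

/-- `sup h(B(x, ε))` in `[0, ∞]`, for a nonnegative function `h`; `B` is the open ball. -/
noncomputable def ballSup {E : Type*} [NormedAddCommGroup E] (h : E → ℝ) (x : E) (ε : ℝ) :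
    ℝ≥0∞ :=
  ⨆ y ∈ Metric.ball x ε, ENNReal.ofReal (h y)

/-- `inf h(B(x, ε))` in `[0, ∞]`, for a nonnegative function `h`; `B` is the open ball. -/
noncomputable def ballInf {E : Type*} [NormedAddCommGroup E] (h : E → ℝ) (x : E) (ε : ℝ) :
    ℝ≥0∞ :=
  ⨅ y ∈ Metric.ball x ε, ENNReal.ofReal (h y)

end Quantization

/-! Write p = r + d and K = c₂₁ n^{-1/d}. Near x the density has a positive lower bound m, so (51)
makes α_n R-dense there with R = K m^{-1/p} → 0. By star-shapedness a cell containing x then lies in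
the R-ball about its centre (`voronoiCell_subset_closedBall`), so it shrinks to x and only h near x
matters.

Upper bounds: on the cell ‖y-a‖ = d(y,α_n), so (51) reads h(y) ≤ K^p ‖y-a‖^{-p}. Together with h ≤ M
this is integrated radially, splitting at the radius ρ where the two bounds agree. The mass integral
converges at infinity and has order K^d M^{r/p} (`setLIntegral_density_le`). For the inertia the
outer integrand is K^p ‖y-a‖^{-d}, the critical power, so the annulus ρ < ‖y-a‖ ≤ R contributes
log(R/ρ) = log(M/m)/p (`setLIntegral_inertia_le`).

Lower bounds: deleting a from α_n raises the distortion by at most (4R)^r P(W₀), because the second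
nearest codepoint is within 4R (`infEDist_sdiff_le`, `distortion_erase_le`). Conversely, one extra
point always gains at least a constant times n^{-(1+r/d)}, since by volume every codebook leaves a
hole of size n^{-1/d} in the unit ball (`exists_errorPow_succ_add_le`). Optimality compares the two
and gives P(W₀) ≥ const · m^{r/p}/n. A set of mass q with density at most M cannot concentrate near
a, so its inertia is at least of order (q/M)^{r/d} q, which yields the power (m/M)^{r/d}.

At the end m and M tend to the lower and upper limits of h at x. All bounds on h are taken on
punctured neighbourhoods, so the value h(x) must never matter: {x} is null and the distance to α_n
is continuous. -/

namespace Quantization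

/-! ### Polar integration of powers of the norm. -/

section Radial

variable {E : Type*} [NormedAddCommGroup E] [NormedSpace ℝ E] [FiniteDimensional ℝ E]
  [MeasurableSpace E] [BorelSpace E]

/-- Integration of a nonnegative radial function about the point `a`. -/
lemma lintegral_radial [Nontrivial E] (lam : Measure E) [lam.IsAddHaarMeasure] (a : E) {f : ℝ → ℝ}
    (hf : ∀ t, 0 ≤ f t)
    (hint : IntegrableOn (fun t : ℝ => t ^ (Module.finrank ℝ E - 1) * f t) (Ioi 0)) :
    ∫⁻ y, ENNReal.ofReal (f ‖y - a‖) ∂lam =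
      ENNReal.ofReal (Module.finrank ℝ E * (lam.real (Metric.ball 0 1) *
        ∫ t in Ioi (0 : ℝ), t ^ (Module.finrank ℝ E - 1) * f t)) := by
  rw [lintegral_sub_right_eq_self (fun y => ENNReal.ofReal (f ‖y‖)) a,
    ← ofReal_integral_eq_lintegral_ofReal]
  · rw [integral_fun_norm_addHaar]
    simp
  · exact (integrable_fun_norm_addHaar lam (f := f)).2 (by simpa using hint)
  · exact ae_of_all _ fun y => hf _

/-- Integral of a power of the norm over the complement of a ball. -/
lemma setLIntegral_norm_rpow_compl_closedBall [Nontrivial E] (lam : Measure E)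
    [lam.IsAddHaarMeasure] (a : E) {r ρ : ℝ} (hr : 0 < r) (hρ : 0 < ρ) :
    ∫⁻ y in (Metric.closedBall a ρ)ᶜ,
        ENNReal.ofReal (‖y - a‖ ^ (-(r + (Module.finrank ℝ E : ℝ)))) ∂lam =
      ENNReal.ofReal (Module.finrank ℝ E * (lam.real (Metric.ball 0 1) * (ρ ^ (-r) / r))) := by
  have hd : 1 ≤ Module.finrank ℝ E := Module.finrank_pos
  set d := Module.finrank ℝ E
  -- The Jacobian t^{d-1} turns the exponent -(r+d) into -r-1, integrable at infinity because r > 0.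
  have key : ∀ t ∈ Ioi (0 : ℝ), t ^ (d - 1) *
      (Ioi ρ).indicator (fun t : ℝ => t ^ (-(r + (d : ℝ)))) t =
      (Ioi ρ).indicator (fun t : ℝ => t ^ (-r - 1)) t := by
    intro t ht
    by_cases h : t ∈ Ioi ρ
    · rw [indicator_of_mem h, indicator_of_mem h, ← Real.rpow_natCast, ← Real.rpow_add ht]
      congr 1
      push_cast [hd]
      ring
    · simp [indicator_of_notMem h]
  have hsub : Ioi ρ ⊆ Ioi (0 : ℝ) := Ioi_subset_Ioi hρ.le
  rw [← lintegral_indicator Metric.isClosed_closedBall.measurableSet.compl]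
  have := lintegral_radial lam a (f := (Ioi ρ).indicator fun t : ℝ => t ^ (-(r + (d : ℝ))))
    (fun t => indicator_nonneg (fun s hs => Real.rpow_nonneg (hρ.le.trans (le_of_lt hs)) _) t) ?_
  · rw [setIntegral_congr_fun measurableSet_Ioi key, setIntegral_indicator measurableSet_Ioi,
      inter_eq_right.2 hsub, integral_Ioi_rpow_of_lt (by linarith) hρ] at this
    rw [show ρ ^ (-r) / r = -ρ ^ (-r - 1 + 1) / (-r - 1 + 1) by
      rw [sub_add_cancel, neg_div_neg_eq], ← this]
    refine lintegral_congr fun y => ?_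
    by_cases h : ‖y - a‖ ∈ Ioi ρ
    · rw [indicator_of_mem (by simpa [dist_eq_norm] using h), indicator_of_mem h]
    · rw [indicator_of_notMem (by simpa [dist_eq_norm] using h), indicator_of_notMem h]
      simp
  · refine IntegrableOn.congr_fun ?_ (fun t ht => (key t ht).symm) measurableSet_Ioi
    exact ((integrableOn_Ioi_rpow_of_lt (by linarith) hρ).integrable_indicator
      measurableSet_Ioi).integrableOn

/-- Integral of the critical power of the norm over an annulus. -/
lemma setLIntegral_norm_rpow_annulus [Nontrivial E] (lam : Measure E)
    [lam.IsAddHaarMeasure] (a : E) {ρ R : ℝ} (hρ : 0 < ρ) (hR : ρ ≤ R) :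
    ∫⁻ y in Metric.closedBall a R \ Metric.closedBall a ρ,
        ENNReal.ofReal (‖y - a‖ ^ (-(Module.finrank ℝ E : ℝ))) ∂lam =
      ENNReal.ofReal (Module.finrank ℝ E * (lam.real (Metric.ball 0 1) * Real.log (R / ρ))) := by
  have hd : 1 ≤ Module.finrank ℝ E := Module.finrank_pos
  set d := Module.finrank ℝ E
  -- At the critical exponent the Jacobian leaves t⁻¹; this is the source of the logarithm.
  have key : ∀ t ∈ Ioi (0 : ℝ), t ^ (d - 1) *
      (Ioc ρ R).indicator (fun t : ℝ => t ^ (-(d : ℝ))) t =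
      (Ioc ρ R).indicator (fun t : ℝ => t⁻¹) t := by
    intro t ht
    by_cases h : t ∈ Ioc ρ R
    · rw [indicator_of_mem h, indicator_of_mem h, ← Real.rpow_natCast, ← Real.rpow_add ht,
        ← Real.rpow_neg_one]
      congr 1
      push_cast [hd]
      ring
    · simp [indicator_of_notMem h]
  have hsub : Ioc ρ R ⊆ Ioi (0 : ℝ) := fun t ht => hρ.trans ht.1
  rw [← lintegral_indicator (Metric.isClosed_closedBall.measurableSet.diff
    Metric.isClosed_closedBall.measurableSet)]
  have := lintegral_radial lam a (f := (Ioc ρ R).indicator fun t : ℝ => t ^ (-(d : ℝ)))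
    (fun t => indicator_nonneg (fun s hs => Real.rpow_nonneg (hρ.le.trans (le_of_lt hs.1)) _) t) ?_
  · rw [setIntegral_congr_fun measurableSet_Ioi key, setIntegral_indicator measurableSet_Ioc,
      inter_eq_right.2 hsub, ← intervalIntegral.integral_of_le hR,
      integral_inv_of_pos hρ (hρ.trans_le hR)] at this
    rw [← this]
    refine lintegral_congr fun y => ?_
    by_cases h : ‖y - a‖ ∈ Ioc ρ R
    · rw [indicator_of_mem (by simpa [dist_eq_norm, and_comm] using h), indicator_of_mem h]
    · rw [indicator_of_notMem (by simpa [dist_eq_norm, and_comm, -not_and] using h),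
        indicator_of_notMem h]
      simp
  · refine IntegrableOn.congr_fun ?_ (fun t ht => (key t ht).symm) measurableSet_Ioi
    refine (IntegrableOn.integrable_indicator ?_ measurableSet_Ioc).integrableOn
    rw [← intervalIntegrable_iff_integrableOn_Ioc_of_le hR]
    exact intervalIntegral.intervalIntegrable_inv (fun t ht => by
      rw [uIcc_of_le hR] at ht
      exact (hρ.trans_le ht.1).ne') continuousOn_id

end Radial

/-- Solves the micro-macro bound for the density: with t = ‖y-a‖ it says that the density at
distance t is at most K^p t^{-p}. -/
lemma mul_rpow_le_of_le_mul_rpow_neg {t K y p : ℝ} (ht : 0 ≤ t) (hK : 0 < K) (hy : 0 < y)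
    (hp : 0 < p) (h : t ≤ K * y ^ (-(1 / p))) : y * t ^ p ≤ K ^ p := by
  calc y * t ^ p ≤ y * (K * y ^ (-(1 / p))) ^ p := by gcongr
    _ = K ^ p := by
      rw [Real.mul_rpow hK.le (by positivity), ← Real.rpow_mul hy.le,
        show -(1 / p) * p = -1 by field_simp, Real.rpow_neg_one]
      field_simp

lemma edist_rpow_mul_ofReal {E : Type*} [NormedAddCommGroup E] {a y : E} {r t : ℝ} (hr : 0 ≤ r) :
    edist y a ^ r * ENNReal.ofReal t = ENNReal.ofReal (‖y - a‖ ^ r * t) := by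
  rw [edist_dist, dist_eq_norm, ENNReal.ofReal_rpow_of_nonneg (norm_nonneg _) hr,
    ← ENNReal.ofReal_mul (by positivity)]

lemma measure_unitBall_real_pos {E : Type*} [NormedAddCommGroup E] [NormedSpace ℝ E]
    [FiniteDimensional ℝ E] [MeasurableSpace E] (lam : Measure E) [lam.IsAddHaarMeasure] :
    0 < lam.real (Metric.ball (0 : E) 1) :=
  ENNReal.toReal_pos (Metric.measure_ball_pos lam 0 one_pos).ne' measure_ball_lt_top.ne

/-! ### Mass and inertia of a single set under pointwise density bounds. -/

section Density

variable {E : Type*} [NormedAddCommGroup E] [NormedSpace ℝ E] [FiniteDimensional ℝ E]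
  [MeasurableSpace E] [BorelSpace E]

lemma addHaar_closedBall_eq_ofReal (lam : Measure E) [lam.IsAddHaarMeasure] (a : E) {s : ℝ}
    (hs : 0 ≤ s) :
    lam (Metric.closedBall a s) =
      ENNReal.ofReal (s ^ Module.finrank ℝ E * lam.real (Metric.ball 0 1)) := by
  rw [Measure.addHaar_closedBall _ _ hs, ENNReal.ofReal_mul (by positivity), ofReal_measureReal]

/-- The mass of a density bounded by `M` on a set contained in a ball of radius `s`. -/
lemma setLIntegral_density_closedBall_le (lam : Measure E) [lam.IsAddHaarMeasure] {h : E → ℝ}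
    {W : Set E} (hW : MeasurableSet W) {M : ℝ} (hM : 0 < M)
    (hle : ∀ᵐ y ∂lam, y ∈ W → h y ≤ M) (a : E) {s : ℝ} (hs : 0 ≤ s) :
    ∫⁻ y in W ∩ Metric.closedBall a s, ENNReal.ofReal (h y) ∂lam ≤
      ENNReal.ofReal (M * (s ^ Module.finrank ℝ E * lam.real (Metric.ball 0 1))) := by
  have hm := hW.inter (Metric.isClosed_closedBall (x := a) (ε := s)).measurableSet
  calc ∫⁻ y in W ∩ Metric.closedBall a s, ENNReal.ofReal (h y) ∂lam
      ≤ ∫⁻ _ in W ∩ Metric.closedBall a s, ENNReal.ofReal M ∂lam := by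
        refine setLIntegral_mono_ae' hm ?_
        filter_upwards [hle] with y hy hyW using ENNReal.ofReal_le_ofReal (hy hyW.1)
    _ ≤ ENNReal.ofReal M * lam (Metric.closedBall a s) := by
        rw [setLIntegral_const]
        gcongr
        exact inter_subset_right
    _ = _ := by
        rw [addHaar_closedBall_eq_ofReal _ _ hs, ← ENNReal.ofReal_mul hM.le]

/-- Upper bound for the mass of a set on which the density `h` is at most `M` and the
distance to `a` is at most `K h^{-1/(r+d)}`. -/
lemma setLIntegral_density_le [Nontrivial E] (lam : Measure E) [lam.IsAddHaarMeasure] {h : E → ℝ}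
    {W : Set E} (hW : MeasurableSet W) {M K r : ℝ} (hM : 0 < M) (hK : 0 < K) (hr : 0 < r)
    (hle : ∀ᵐ y ∂lam, y ∈ W → h y ≤ M) (a : E)
    (hdist : ∀ y ∈ W, 0 < h y ∧ ‖y - a‖ ≤ K * h y ^ (-(1 / (r + (Module.finrank ℝ E : ℝ))))) :
    ∫⁻ y in W, ENNReal.ofReal (h y) ∂lam ≤
      ENNReal.ofReal (lam.real (Metric.ball (0 : E) 1) * (1 + Module.finrank ℝ E / r) *
        K ^ Module.finrank ℝ E * M ^ (r / (r + (Module.finrank ℝ E : ℝ)))) := by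
  have hd : 1 ≤ Module.finrank ℝ E := Module.finrank_pos
  have hV := measure_unitBall_real_pos lam
  set V := lam.real (Metric.ball (0 : E) 1)
  have hd0 : (0 : ℝ) < Module.finrank ℝ E := by exact_mod_cast hd
  set p : ℝ := r + (Module.finrank ℝ E : ℝ) with hp_def
  have hp : 0 < p := by positivity
  -- The radius at which the bounds M and K^p ρ^{-p} on the density coincide. Hence the inner and
  -- outer parts have the same order, as `e1` and `e2` confirm.
  set ρ : ℝ := K * M ^ (-(1 / p)) with hρ_def
  have hρ : 0 < ρ := by positivity
  have hcB : MeasurableSet (Metric.closedBall a ρ) := Metric.isClosed_closedBall.measurableSet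
  have h1 := setLIntegral_density_closedBall_le lam hW hM hle a hρ.le
  have h2 : ∫⁻ y in W \ Metric.closedBall a ρ, ENNReal.ofReal (h y) ∂lam ≤
      ENNReal.ofReal (K ^ p * (Module.finrank ℝ E * (V * (ρ ^ (-r) / r)))) := by
    calc ∫⁻ y in W \ Metric.closedBall a ρ, ENNReal.ofReal (h y) ∂lam
        ≤ ∫⁻ y in W \ Metric.closedBall a ρ,
            ENNReal.ofReal (K ^ p) * ENNReal.ofReal (‖y - a‖ ^ (-p)) ∂lam := by
          refine setLIntegral_mono' (hW.diff hcB) fun y hy => ?_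
          obtain ⟨hpos, hy1⟩ := hdist y hy.1
          have hn : 0 < ‖y - a‖ := hρ.trans (by simpa [dist_eq_norm] using hy.2)
          rw [← ENNReal.ofReal_mul (by positivity)]
          refine ENNReal.ofReal_le_ofReal ?_
          rw [Real.rpow_neg hn.le, ← div_eq_mul_inv, le_div_iff₀ (by positivity)]
          exact mul_rpow_le_of_le_mul_rpow_neg hn.le hK hpos hp hy1
      _ ≤ ∫⁻ y in (Metric.closedBall a ρ)ᶜ,
            ENNReal.ofReal (K ^ p) * ENNReal.ofReal (‖y - a‖ ^ (-p)) ∂lam :=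
          lintegral_mono_set fun y hy => hy.2
      _ = _ := by
          rw [lintegral_const_mul' _ _ ENNReal.ofReal_ne_top,
            setLIntegral_norm_rpow_compl_closedBall lam a hr hρ,
            ← ENNReal.ofReal_mul (by positivity)]
  rw [← lintegral_inter_add_sdiff _ W hcB]
  refine (add_le_add h1 h2).trans ?_
  rw [← ENNReal.ofReal_add (by positivity) (by positivity)]
  refine (ENNReal.ofReal_le_ofReal (le_of_eq ?_))
  have e1 : M * ρ ^ Module.finrank ℝ E = K ^ Module.finrank ℝ E * M ^ (r / p) := by
    rw [hρ_def, mul_pow, ← Real.rpow_mul_natCast hM.le, mul_left_comm]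
    congr 1
    nth_rewrite 1 [← Real.rpow_one M]
    rw [← Real.rpow_add hM]
    congr 1
    rw [hp_def]
    field_simp
    ring
  have e2 : K ^ p * ρ ^ (-r) = K ^ Module.finrank ℝ E * M ^ (r / p) := by
    rw [hρ_def, Real.mul_rpow hK.le (by positivity), ← mul_assoc, ← Real.rpow_add hK,
      ← Real.rpow_mul hM.le, ← Real.rpow_natCast]
    congr 2
    · rw [hp_def]; ring
    · ring
  calc M * (ρ ^ Module.finrank ℝ E * V) + K ^ p * (Module.finrank ℝ E * (V * (ρ ^ (-r) / r)))
      = (M * ρ ^ Module.finrank ℝ E) * V + (K ^ p * ρ ^ (-r)) * V * (Module.finrank ℝ E / r) := by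
        ring
    _ = _ := by rw [e1, e2]; ring

/-- Upper bound for the inertia of a set on which the density `h` is at most `M` and the
distance to `a` is at most `K h^{-1/(r+d)}` and at most `K m^{-1/(r+d)}`. -/
lemma setLIntegral_inertia_le [Nontrivial E] (lam : Measure E) [lam.IsAddHaarMeasure] {h : E → ℝ}
    {W : Set E} (hW : MeasurableSet W) {M m K r : ℝ} (hm : 0 < m) (hmM : m ≤ M) (hK : 0 < K)
    (hr : 0 < r) (hle : ∀ᵐ y ∂lam, y ∈ W → h y ≤ M) (a : E)
    (hdist : ∀ y ∈ W, 0 < h y ∧ ‖y - a‖ ≤ K * h y ^ (-(1 / (r + (Module.finrank ℝ E : ℝ)))))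
    (hsub : W ⊆ Metric.closedBall a (K * m ^ (-(1 / (r + (Module.finrank ℝ E : ℝ)))))) :
    ∫⁻ y in W, edist y a ^ r * ENNReal.ofReal (h y) ∂lam ≤
      ENNReal.ofReal (lam.real (Metric.ball (0 : E) 1) *
        K ^ (r + (Module.finrank ℝ E : ℝ)) * (1 + Real.log (M / m))) := by
  have hd : 1 ≤ Module.finrank ℝ E := Module.finrank_pos
  have hV := measure_unitBall_real_pos lam
  set V := lam.real (Metric.ball (0 : E) 1)
  have hM : 0 < M := hm.trans_le hmM
  have hd0 : (0 : ℝ) < Module.finrank ℝ E := by exact_mod_cast hd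
  set p : ℝ := r + (Module.finrank ℝ E : ℝ) with hp_def
  have hp : 0 < p := by positivity
  set ρ : ℝ := K * M ^ (-(1 / p)) with hρ_def
  set R : ℝ := K * m ^ (-(1 / p)) with hR_def
  have hρ : 0 < ρ := by positivity
  have hR : 0 < R := by positivity
  have hlog : 0 ≤ Real.log (M / m) := Real.log_nonneg ((one_le_div hm).2 hmM)
  -- K cancels, so the logarithm depends only on the oscillation of the density.
  have hratio : R / ρ = (M / m) ^ (1 / p) := by
    rw [hρ_def, hR_def, Real.div_rpow hM.le hm.le, Real.rpow_neg hm.le, Real.rpow_neg hM.le]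
    have := Real.rpow_pos_of_pos hM (1 / p)
    have := Real.rpow_pos_of_pos hm (1 / p)
    field_simp
  have hρR : ρ ≤ R := by
    rw [← one_le_div hρ, hratio]
    exact Real.one_le_rpow ((one_le_div hm).2 hmM) (by positivity)
  have hcB : MeasurableSet (Metric.closedBall a ρ) := Metric.isClosed_closedBall.measurableSet
  have h1 : ∫⁻ y in W ∩ Metric.closedBall a ρ, edist y a ^ r * ENNReal.ofReal (h y) ∂lam ≤
      ENNReal.ofReal (V * K ^ p) := by
    calc ∫⁻ y in W ∩ Metric.closedBall a ρ, edist y a ^ r * ENNReal.ofReal (h y) ∂lam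
        ≤ ∫⁻ y in W ∩ Metric.closedBall a ρ,
            ENNReal.ofReal (ρ ^ r) * ENNReal.ofReal (h y) ∂lam := by
          refine setLIntegral_mono' (hW.inter hcB) fun y hy => ?_
          gcongr
          rw [← ENNReal.ofReal_rpow_of_nonneg hρ.le hr.le]
          gcongr
          rw [edist_dist]
          exact ENNReal.ofReal_le_ofReal hy.2
      _ ≤ ENNReal.ofReal (ρ ^ r) * ENNReal.ofReal (M * (ρ ^ Module.finrank ℝ E * V)) := by
          rw [lintegral_const_mul' _ _ ENNReal.ofReal_ne_top]
          gcongr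
          exact setLIntegral_density_closedBall_le lam hW hM hle a hρ.le
      _ = _ := by
          rw [← ENNReal.ofReal_mul (by positivity)]
          congr 1
          have : ρ ^ r * ρ ^ Module.finrank ℝ E * M = K ^ p := by
            rw [← Real.rpow_natCast, ← Real.rpow_add hρ, ← hp_def, hρ_def,
              Real.mul_rpow hK.le (by positivity), ← Real.rpow_mul hM.le,
              show -(1 / p) * p = -1 by field_simp, Real.rpow_neg_one]
            field_simp
          rw [← this]; ring
  have h2 : ∫⁻ y in W \ Metric.closedBall a ρ, edist y a ^ r * ENNReal.ofReal (h y) ∂lam ≤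
      ENNReal.ofReal (K ^ p * (Module.finrank ℝ E * (V * Real.log (R / ρ)))) := by
    calc ∫⁻ y in W \ Metric.closedBall a ρ, edist y a ^ r * ENNReal.ofReal (h y) ∂lam
        ≤ ∫⁻ y in W \ Metric.closedBall a ρ, ENNReal.ofReal (K ^ p) *
            ENNReal.ofReal (‖y - a‖ ^ (-(Module.finrank ℝ E : ℝ))) ∂lam := by
          refine setLIntegral_mono' (hW.diff hcB) fun y hy => ?_
          obtain ⟨hpos, hy1⟩ := hdist y hy.1
          have hn : 0 < ‖y - a‖ := hρ.trans (by simpa [dist_eq_norm] using hy.2)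
          rw [edist_rpow_mul_ofReal hr.le, ← ENNReal.ofReal_mul (by positivity)]
          refine ENNReal.ofReal_le_ofReal ?_
          rw [Real.rpow_neg hn.le, ← div_eq_mul_inv, le_div_iff₀ (by positivity)]
          refine le_trans (le_of_eq ?_) (mul_rpow_le_of_le_mul_rpow_neg hn.le hK hpos hp hy1)
          rw [hp_def, Real.rpow_add hn]; ring
      _ ≤ ∫⁻ y in Metric.closedBall a R \ Metric.closedBall a ρ, ENNReal.ofReal (K ^ p) *
            ENNReal.ofReal (‖y - a‖ ^ (-(Module.finrank ℝ E : ℝ))) ∂lam :=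
          lintegral_mono_set fun y hy => ⟨hsub hy.1, hy.2⟩
      _ = _ := by
          rw [lintegral_const_mul' _ _ ENNReal.ofReal_ne_top,
            setLIntegral_norm_rpow_annulus lam a hρ hρR, ← ENNReal.ofReal_mul (by positivity)]
  rw [← lintegral_inter_add_sdiff _ W hcB]
  refine (add_le_add h1 h2).trans ?_
  rw [hratio, Real.log_rpow (by positivity), ← ENNReal.ofReal_add (by positivity) (by positivity)]
  refine ENNReal.ofReal_le_ofReal ?_
  -- The factor d from polar integration is absorbed by the 1/p that comes out of the logarithm.
  have : (Module.finrank ℝ E : ℝ) * (1 / p) ≤ 1 := by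
    rw [mul_one_div, div_le_one hp, hp_def]; linarith
  calc V * K ^ p + K ^ p * (Module.finrank ℝ E * (V * (1 / p * Real.log (M / m))))
      = V * K ^ p + V * K ^ p * (Module.finrank ℝ E * (1 / p) * Real.log (M / m)) := by ring
    _ ≤ V * K ^ p + V * K ^ p * (1 * Real.log (M / m)) := by gcongr
    _ = _ := by ring

/-- Lower bound for the inertia of a set of mass at least `q` on which the density is at most
`M`. -/
lemma le_setLIntegral_inertia [Nontrivial E] (lam : Measure E) [lam.IsAddHaarMeasure]
    {h : E → ℝ} {W : Set E} (hW : MeasurableSet W) {M q r : ℝ} (hM : 0 < M) (hq : 0 < q)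
    (hr : 0 < r) (hle : ∀ᵐ y ∂lam, y ∈ W → h y ≤ M) (a : E)
    (hmass : ENNReal.ofReal q ≤ ∫⁻ y in W, ENNReal.ofReal (h y) ∂lam) :
    ENNReal.ofReal ((q / (2 * M * lam.real (Metric.ball (0 : E) 1))) ^
        (r / (Module.finrank ℝ E : ℝ)) * (q / 2)) ≤
      ∫⁻ y in W, edist y a ^ r * ENNReal.ofReal (h y) ∂lam := by
  have hd : 1 ≤ Module.finrank ℝ E := Module.finrank_pos
  have hV := measure_unitBall_real_pos lam
  set V := lam.real (Metric.ball (0 : E) 1)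
  have hd0 : (0 : ℝ) < Module.finrank ℝ E := by exact_mod_cast hd
  -- Chosen so that the ball of radius s has volume q/(2M): at most half of the mass q fits inside,
  -- and the rest lies at distance more than s from a.
  set s : ℝ := (q / (2 * M * V)) ^ (1 / (Module.finrank ℝ E : ℝ)) with hs_def
  have hs : 0 < s := by positivity
  have hcB : MeasurableSet (Metric.closedBall a s) := Metric.isClosed_closedBall.measurableSet
  have h1 : ∫⁻ y in W ∩ Metric.closedBall a s, ENNReal.ofReal (h y) ∂lam ≤
      ENNReal.ofReal (q / 2) := by
    refine (setLIntegral_density_closedBall_le lam hW hM hle a hs.le).trans (le_of_eq ?_)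
    congr 1
    rw [hs_def, ← Real.rpow_mul_natCast (by positivity), one_div_mul_cancel hd0.ne', Real.rpow_one]
    change M * (q / (2 * M * V) * V) = q / 2
    field_simp
  have h2 : ENNReal.ofReal (q / 2) ≤
      ∫⁻ y in W \ Metric.closedBall a s, ENNReal.ofReal (h y) ∂lam := by
    rw [← lintegral_inter_add_sdiff _ W hcB] at hmass
    have h3 := hmass.trans (add_le_add_left h1 _)
    nth_rewrite 1 [← add_halves q] at h3
    rw [ENNReal.ofReal_add (by positivity) (by positivity)] at h3
    exact (ENNReal.add_le_add_iff_left ENNReal.ofReal_ne_top).1 h3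
  calc ENNReal.ofReal ((q / (2 * M * V)) ^ (r / (Module.finrank ℝ E : ℝ)) * (q / 2))
      = ENNReal.ofReal (s ^ r) * ENNReal.ofReal (q / 2) := by
        rw [← ENNReal.ofReal_mul (by positivity), hs_def, ← Real.rpow_mul (by positivity)]
        congr 3
        ring
    _ ≤ ENNReal.ofReal (s ^ r) *
          ∫⁻ y in W \ Metric.closedBall a s, ENNReal.ofReal (h y) ∂lam := by gcongr
    _ = ∫⁻ y in W \ Metric.closedBall a s, ENNReal.ofReal (s ^ r) * ENNReal.ofReal (h y) ∂lam := by
        rw [lintegral_const_mul' _ _ ENNReal.ofReal_ne_top]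
    _ ≤ ∫⁻ y in W \ Metric.closedBall a s, edist y a ^ r * ENNReal.ofReal (h y) ∂lam := by
        refine setLIntegral_mono' (hW.diff hcB) fun y hy => ?_
        gcongr
        rw [← ENNReal.ofReal_rpow_of_nonneg hs.le hr.le]
        gcongr
        rw [edist_dist]
        exact ENNReal.ofReal_le_ofReal (not_le.1 hy.2).le
    _ ≤ _ := lintegral_mono_set sdiff_subset

end Density

/-! ### Geometry of Voronoi cells and the cost of deleting a codepoint. -/

section Cells

variable {E : Type*} [NormedAddCommGroup E]

lemma infEDist_eq_min_sdiff {a : E} {α : Finset E} (ha : a ∈ α) (y : E) :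
    Metric.infEDist y (α : Set E) = min (edist y a) (Metric.infEDist y ((α : Set E) \ {a})) := by
  rw [← Metric.infEDist_singleton (x := y) (y := a), ← Metric.infEDist_union,
    union_sdiff_cancel (by simpa using ha)]

lemma openVoronoiCell_subset {a : E} {α : Finset E} (ha : a ∈ α) :
    openVoronoiCell a α ⊆ voronoiCell a α := fun y hy => by
  have hy' : edist y a < Metric.infEDist y ((α : Set E) \ {a}) := hy
  simp [voronoiCell, infEDist_eq_min_sdiff ha, hy'.le]

lemma isClosed_voronoiCell (a : E) (α : Finset E) : IsClosed (voronoiCell a α) :=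
  isClosed_eq (by fun_prop) Metric.continuous_infEDist

lemma isOpen_openVoronoiCell (a : E) (α : Finset E) : IsOpen (openVoronoiCell a α) :=
  isOpen_lt (by fun_prop) Metric.continuous_infEDist

/-- A Voronoi cell that meets a ball on which the codebook is `R`-dense is contained in the
`R`-ball about its centre. -/
lemma voronoiCell_subset_closedBall [NormedSpace ℝ E] {a x : E} {α : Finset E} {R ε : ℝ}
    (hR : 0 < R) (hRε : 3 * R < ε)
    (hd : ∀ y ∈ Metric.ball x ε, Metric.infEDist y (α : Set E) ≤ ENNReal.ofReal R)
    (hx : x ∈ voronoiCell a α) :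
    voronoiCell a α ⊆ Metric.closedBall a R := by
  have hball : ∀ y ∈ Metric.ball x ε, y ∈ voronoiCell a α → dist y a ≤ R := fun y hy hya => by
    have h1 : edist y a = Metric.infEDist y (α : Set E) := hya
    have h2 := h1 ▸ hd y hy
    rwa [edist_dist, ENNReal.ofReal_le_ofReal_iff hR.le] at h2
  have hxa := hball x (Metric.mem_ball_self (by linarith)) hx
  intro y hy
  by_contra hyR
  have hyR : R < dist y a := by simpa using hyR
  -- If y in the cell were farther than R from a, move along the segment from a to y to a point z at
  -- distance s with R < s ≤ 2R. Since x is within R of a, z is within 3R of x, where the codebook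
  -- is R-dense.
  set s : ℝ := min (dist y a) (2 * R) with hs_def
  have hs : R < s := lt_min hyR (by linarith)
  have hs2 : s ≤ 2 * R := min_le_right _ _
  have hs1 : s ≤ dist y a := min_le_left _ _
  have hpos : 0 < dist y a := hR.trans hyR
  have hn : ‖y - a‖ = dist y a := (dist_eq_norm _ _).symm
  set z : E := a + (s / dist y a) • (y - a) with hz_def
  have hza : dist z a = s := by
    rw [dist_eq_norm, hz_def, add_sub_cancel_left, norm_smul, hn, Real.norm_of_nonneg
      (by have := hR.trans hs; positivity), div_mul_cancel₀ _ hpos.ne']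
  have hyz : dist y z = dist y a - s := by
    have : y - z = (1 - s / dist y a) • (y - a) := by
      rw [hz_def, sub_smul, one_smul]; abel
    rw [dist_eq_norm, this, norm_smul, hn, Real.norm_of_nonneg, sub_mul, one_mul,
      div_mul_cancel₀ _ hpos.ne']
    rw [sub_nonneg, div_le_one hpos]
    exact hs1
  have hzx : z ∈ Metric.ball x ε := by
    rw [Metric.mem_ball]
    have := dist_triangle z a x
    rw [dist_comm a x] at this
    linarith
  have hzball := hd z hzx
  -- Star-shapedness of the cell: ‖z-b‖ ≥ ‖y-b‖ - ‖y-z‖ ≥ ‖y-a‖ - (‖y-a‖ - s) = s for every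
  -- codepoint b.
  have hzle : ENNReal.ofReal s ≤ Metric.infEDist z (α : Set E) := by
    rw [Metric.le_infEDist]
    intro b hb
    rw [edist_dist]
    refine ENNReal.ofReal_le_ofReal ?_
    have h1 : edist y a ≤ edist y b := by
      have h0 : edist y a = Metric.infEDist y (α : Set E) := hy
      rw [h0]
      exact Metric.infEDist_le_edist_of_mem hb
    rw [edist_dist, edist_dist, ENNReal.ofReal_le_ofReal_iff dist_nonneg] at h1
    have h2 := dist_triangle y z b
    linarith
  have := hzle.trans hzball
  rw [ENNReal.ofReal_le_ofReal_iff hR.le] at this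
  linarith

/-- Under the same density assumption the second nearest codepoint is at distance at most
`4 R`. -/
lemma infEDist_sdiff_le [NormedSpace ℝ E] [Nontrivial E] {a x : E} {α : Finset E} {R ε : ℝ}
    (hR : 0 < R) (hRε : 3 * R < ε) (ha : a ∈ α)
    (hd : ∀ y ∈ Metric.ball x ε, Metric.infEDist y (α : Set E) ≤ ENNReal.ofReal R)
    (hx : x ∈ voronoiCell a α) {y : E} (hy : y ∈ openVoronoiCell a α) :
    Metric.infEDist y ((α : Set E) \ {a}) ≤ ENNReal.ofReal (4 * R) := by
  have hsub := voronoiCell_subset_closedBall hR hRε hd hx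
  have hxa : dist x a ≤ R := hsub hx
  have hya : dist y a ≤ R := hsub (openVoronoiCell_subset ha hy)
  -- The codepoint b nearest to a + v is within R of it, hence differs from a, which is 2R away. The
  -- path y, a, a + v, b has length at most R + 2R + R.
  obtain ⟨v, hv⟩ := exists_norm_eq E (show 0 ≤ 2 * R by linarith)
  have hza : dist (a + v) a = 2 * R := by rw [dist_eq_norm, add_sub_cancel_left, hv]
  have hz : a + v ∈ Metric.ball x ε := by
    rw [Metric.mem_ball]
    have := dist_triangle (a + v) a x
    rw [dist_comm a x] at this
    linarith
  obtain ⟨b, hb, hzb⟩ := α.finite_toSet.isCompact.exists_infEDist_eq_edist ⟨a, ha⟩ (a + v)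
  have h1 := hd _ hz
  rw [hzb, edist_dist, ENNReal.ofReal_le_ofReal_iff hR.le] at h1
  have hba : b ≠ a := by
    rintro rfl
    linarith
  refine (Metric.infEDist_le_edist_of_mem (show b ∈ (α : Set E) \ {a} from ⟨hb, hba⟩)).trans ?_
  rw [edist_dist]
  refine ENNReal.ofReal_le_ofReal ?_
  have h2 := dist_triangle y a b
  have h3 := dist_triangle a (a + v) b
  rw [dist_comm a (a + v)] at h3
  linarith

variable [MeasurableSpace E]

lemma errorPow_le_distortion (P : Measure E) (r : ℝ) {n : ℕ} {α : Finset E} (hα : α.card ≤ n) :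
    errorPow P r n ≤ distortion P r (α : Set E) :=
  iInf₂_le α hα

/-- The one-point codebook {0} suffices, since t^r ≤ 1 + t^{r+δ}. Finiteness is what later allows
the optimal error to be cancelled from both sides. -/
lemma errorPow_ne_top (P : Measure E) [IsProbabilityMeasure P] {r : ℝ} (hr : 0 < r)
    (h_moment : ∃ δ : ℝ, 0 < δ ∧ ∫⁻ x, ‖x‖ₑ ^ (r + δ) ∂P < ⊤) {n : ℕ} (hn : 1 ≤ n) :
    errorPow P r n ≠ ⊤ := by
  obtain ⟨δ, hδ, hlt⟩ := h_moment
  refine ((errorPow_le_distortion P r (α := {(0 : E)}) (by simpa using hn)).trans_lt ?_).ne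
  calc distortion P r (({(0 : E)} : Finset E) : Set E)
      ≤ ∫⁻ x, (1 + ‖x‖ₑ ^ (r + δ)) ∂P := by
        refine lintegral_mono fun x => ?_
        rw [Finset.coe_singleton, Metric.infEDist_singleton, edist_zero_right]
        rcases le_total ‖x‖ₑ 1 with h | h
        · exact le_add_right (ENNReal.rpow_le_one h hr.le)
        · exact le_add_left (ENNReal.rpow_le_rpow_of_exponent_le h (by linarith))
    _ < ⊤ := by
        rw [lintegral_add_left measurable_const]
        simpa using hlt

variable [BorelSpace E]

/-- Removing the point `a` from the codebook `α` increases the distortion only on the open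
Voronoi cell of `a`. -/
lemma distortion_erase_le [DecidableEq E] (P : Measure E) {r R : ℝ} (hr : 0 < r) (hR : 0 ≤ R)
    {a : E} {α : Finset E} (ha : a ∈ α)
    (hd : ∀ y ∈ openVoronoiCell a α,
      Metric.infEDist y ((α : Set E) \ {a}) ≤ ENNReal.ofReal R) :
    distortion P r (α.erase a : Set E) ≤
      distortion P r (α : Set E) + ENNReal.ofReal (R ^ r) * P (openVoronoiCell a α) := by
  have hm := (isOpen_openVoronoiCell a α).measurableSet
  unfold distortion
  rw [← setLIntegral_const, ← lintegral_indicator hm, ← lintegral_add_right _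
    (measurable_const.indicator hm)]
  refine lintegral_mono fun y => ?_
  rw [Finset.coe_erase]
  -- On the open cell the added term alone bounds the new distance; off it, some other codepoint is
  -- at least as near as a, so the distance does not change.
  by_cases hy : y ∈ openVoronoiCell a α
  · simp only [indicator_of_mem hy]
    refine le_add_left ?_
    rw [← ENNReal.ofReal_rpow_of_nonneg hR hr.le]
    exact ENNReal.rpow_le_rpow (hd y hy) hr.le
  · rw [indicator_of_notMem hy, add_zero]
    have : Metric.infEDist y ((α : Set E) \ {a}) ≤ edist y a := not_lt.1 hy
    rw [infEDist_eq_min_sdiff ha, min_eq_right this]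

end Cells

/-! ### The gain from one additional codepoint. -/

section Gain

variable {E : Type*} [NormedAddCommGroup E] [NormedSpace ℝ E] [FiniteDimensional ℝ E]
  [MeasurableSpace E] [BorelSpace E]

/-- A finite set of at most `n` points leaves a point of the unit ball at distance at least
`n^{-1/d} / 2`. -/
lemma exists_mem_ball_le_infEDist [Nontrivial E] {n : ℕ} (hn : 1 ≤ n) {α : Finset E}
    (hα : α.card ≤ n) :
    ∃ y ∈ Metric.ball (0 : E) 1,
      ENNReal.ofReal ((n : ℝ) ^ (-(1 / (Module.finrank ℝ E : ℝ))) / 2) ≤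
        Metric.infEDist y (α : Set E) := by
  have hd : 1 ≤ Module.finrank ℝ E := Module.finrank_pos
  have hn0 : (0 : ℝ) < n := by exact_mod_cast hn
  set t : ℝ := (n : ℝ) ^ (-(1 / (Module.finrank ℝ E : ℝ))) / 2 with ht_def
  have ht : 0 < t := by positivity
  -- Otherwise at most n balls of radius t cover the unit ball, but their total volume is at most n
  -- t^d = 2^{-d} times that of the unit ball.
  by_contra! hcon
  let lam : Measure E := Measure.addHaar
  have hV := measure_unitBall_real_pos lam
  have hsub : Metric.ball (0 : E) 1 ⊆ ⋃ b ∈ α, Metric.closedBall b t := by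
    intro y hy
    obtain ⟨b, hb, hyb⟩ := Metric.infEDist_lt_iff.1 (hcon y hy)
    rw [edist_dist, ENNReal.ofReal_lt_ofReal_iff ht] at hyb
    exact mem_biUnion hb (Metric.mem_closedBall.2 hyb.le)
  have h1 : lam (Metric.ball (0 : E) 1) ≤
      ENNReal.ofReal (n * (t ^ Module.finrank ℝ E * lam.real (Metric.ball 0 1))) := by
    calc lam (Metric.ball (0 : E) 1) ≤ ∑ b ∈ α, lam (Metric.closedBall b t) :=
          (measure_mono hsub).trans (measure_biUnion_finset_le _ _)
      _ = α.card * ENNReal.ofReal (t ^ Module.finrank ℝ E * lam.real (Metric.ball 0 1)) := by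
          simp_rw [addHaar_closedBall_eq_ofReal lam _ ht.le]
          simp
      _ ≤ n * ENNReal.ofReal (t ^ Module.finrank ℝ E * lam.real (Metric.ball 0 1)) := by
          gcongr
      _ = _ := by rw [ENNReal.ofReal_mul hn0.le, ENNReal.ofReal_natCast]
  rw [← ofReal_measureReal (μ := lam) (s := Metric.ball (0 : E) 1),
    ENNReal.ofReal_le_ofReal_iff (by positivity)] at h1
  have h2 : (n : ℝ) * t ^ Module.finrank ℝ E = (1 / 2) ^ Module.finrank ℝ E := by
    rw [ht_def, div_eq_mul_one_div, mul_pow, ← Real.rpow_mul_natCast hn0.le, neg_mul,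
      one_div_mul_cancel (by positivity), Real.rpow_neg_one]
    field_simp
  have h3 : (1 / 2 : ℝ) ^ Module.finrank ℝ E ≤ 1 / 2 :=
    pow_le_of_le_one (by norm_num) (by norm_num) (by omega)
  rw [← mul_assoc, h2] at h1
  nlinarith

/-- Adding one point to a codebook decreases the distortion by at least a constant times
`n^{-(1+r/d)}`. -/
lemma exists_errorPow_succ_add_le [Nontrivial E] (lam : Measure E) [lam.IsAddHaarMeasure]
    {h : E → ℝ} (h_below : BoundedBelowOnBalls h) {r : ℝ} (hr : 0 < r) :
    ∃ g : ℝ, 0 < g ∧ ∀ n : ℕ, 1 ≤ n →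
      errorPow (lam.withDensity fun x => ENNReal.ofReal (h x)) r (n + 1) +
          ENNReal.ofReal (g * (n : ℝ) ^ (-(1 + r / (Module.finrank ℝ E : ℝ)))) ≤
        errorPow (lam.withDensity fun x => ENNReal.ofReal (h x)) r n := by
  classical
  have hd : 1 ≤ Module.finrank ℝ E := Module.finrank_pos
  have hd0 : (0 : ℝ) < Module.finrank ℝ E := by exact_mod_cast hd
  have hV := measure_unitBall_real_pos lam
  -- Radius 2 leaves room for a ball of radius at most 1/8 centred in the unit ball.
  obtain ⟨c, hc, hch⟩ := h_below 2 two_pos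
  set V := lam.real (Metric.ball (0 : E) 1) with hV_def
  have hgap : (0 : ℝ) < (3 / 8) ^ r - (1 / 8) ^ r :=
    sub_pos.2 (Real.rpow_lt_rpow (by norm_num) (by norm_num) hr)
  refine ⟨((3 / 8) ^ r - (1 / 8) ^ r) * (c * ((1 / 8) ^ Module.finrank ℝ E * V)), by positivity,
    fun n hn => ?_⟩
  have hn0 : (0 : ℝ) < n := by exact_mod_cast hn
  set P := lam.withDensity fun x => ENNReal.ofReal (h x) with hP_def
  refine le_iInf₂ fun α hα => ?_
  obtain ⟨y, hy, hyα⟩ := exists_mem_ball_le_infEDist hn hα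
  set τ : ℝ := (n : ℝ) ^ (-(1 / (Module.finrank ℝ E : ℝ))) with hτ_def
  have hτ : 0 < τ := by positivity
  have hτ1 : τ ≤ 1 := Real.rpow_le_one_of_one_le_of_nonpos (by exact_mod_cast hn)
    (by rw [neg_nonpos]; positivity)
  -- On B the new point y is within τ/8, while the old codebook is at distance at least τ/2 - τ/8 =
  -- 3τ/8. The pointwise gain of order τ^r times a mass of order τ^d gives n^{-(1+r/d)}.
  set B := Metric.closedBall y (τ / 8) with hB_def
  have hB : MeasurableSet B := Metric.isClosed_closedBall.measurableSet
  have hPB : ENNReal.ofReal (c * ((τ / 8) ^ Module.finrank ℝ E * V)) ≤ P B := by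
    rw [hP_def, withDensity_apply _ hB, ENNReal.ofReal_mul hc.le,
      ← addHaar_closedBall_eq_ofReal lam y (by positivity), ← setLIntegral_const]
    refine setLIntegral_mono' hB fun z hz => ENNReal.ofReal_le_ofReal (hch z ?_)
    rw [Metric.mem_closedBall] at hz ⊢
    rw [Metric.mem_ball] at hy
    have := dist_triangle z y 0
    linarith
  have hpt : ∀ z, Metric.infEDist z ((insert y α : Finset E) : Set E) ^ r +
      B.indicator (fun _ => ENNReal.ofReal (τ ^ r * ((3 / 8) ^ r - (1 / 8) ^ r))) z ≤
      Metric.infEDist z (α : Set E) ^ r := by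
    intro z
    have hsub : Metric.infEDist z ((insert y α : Finset E) : Set E) ≤
        Metric.infEDist z (α : Set E) := Metric.infEDist_anti (by simp)
    by_cases hz : z ∈ B
    · have hzy : edist z y ≤ ENNReal.ofReal (τ / 8) := by
        rw [edist_dist]; exact ENNReal.ofReal_le_ofReal hz
      have h1 : ENNReal.ofReal (3 / 8 * τ) ≤ Metric.infEDist z (α : Set E) := by
        have h2 := hyα.trans (Metric.infEDist_le_infEDist_add_edist (x := y) (y := z))
        rw [edist_comm y z] at h2
        have h3 := h2.trans (add_le_add_right hzy _)
        rw [show τ / 2 = 3 / 8 * τ + τ / 8 by ring,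
          ENNReal.ofReal_add (by positivity) (by positivity)] at h3
        exact (ENNReal.add_le_add_iff_right ENNReal.ofReal_ne_top).1 h3
      have h4 : Metric.infEDist z ((insert y α : Finset E) : Set E) ≤ ENNReal.ofReal (τ / 8) :=
        (Metric.infEDist_le_edist_of_mem (by simp)).trans hzy
      rw [indicator_of_mem hz]
      calc Metric.infEDist z ((insert y α : Finset E) : Set E) ^ r +
            ENNReal.ofReal (τ ^ r * ((3 / 8) ^ r - (1 / 8) ^ r))
          ≤ ENNReal.ofReal (τ / 8) ^ r + ENNReal.ofReal (τ ^ r * ((3 / 8) ^ r - (1 / 8) ^ r)) := by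
            gcongr
        _ = ENNReal.ofReal (3 / 8 * τ) ^ r := by
            rw [ENNReal.ofReal_rpow_of_nonneg (by positivity) hr.le,
              ENNReal.ofReal_rpow_of_nonneg (by positivity) hr.le,
              ← ENNReal.ofReal_add (by positivity) (by positivity)]
            congr 1
            rw [show τ / 8 = 1 / 8 * τ by ring, Real.mul_rpow (by norm_num) hτ.le,
              Real.mul_rpow (by norm_num) hτ.le]
            ring
        _ ≤ _ := ENNReal.rpow_le_rpow h1 hr.le
    · rw [indicator_of_notMem hz, add_zero]
      exact ENNReal.rpow_le_rpow hsub hr.le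
  calc errorPow P r (n + 1) + _
      ≤ distortion P r ((insert y α : Finset E) : Set E) +
          ENNReal.ofReal (τ ^ r * ((3 / 8) ^ r - (1 / 8) ^ r)) * P B := by
        refine add_le_add (errorPow_le_distortion P r
          ((Finset.card_insert_le _ _).trans (by omega))) ?_
        refine le_trans (le_of_eq ?_) (mul_le_mul_right hPB _)
        rw [← ENNReal.ofReal_mul (by positivity)]
        congr 1
        have : (n : ℝ) ^ (-(1 + r / (Module.finrank ℝ E : ℝ))) =
            τ ^ r * τ ^ Module.finrank ℝ E := by
          rw [hτ_def, ← Real.rpow_mul hn0.le, ← Real.rpow_mul_natCast hn0.le,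
            ← Real.rpow_add hn0]
          congr 1
          field_simp
          ring
        rw [this, div_pow, div_pow, one_pow]
        ring
    _ = ∫⁻ z, (Metric.infEDist z ((insert y α : Finset E) : Set E) ^ r +
          B.indicator (fun _ => ENNReal.ofReal (τ ^ r * ((3 / 8) ^ r - (1 / 8) ^ r))) z) ∂P := by
        rw [lintegral_add_right _ (measurable_const.indicator hB), lintegral_indicator hB,
          setLIntegral_const]
        rfl
    _ ≤ _ := lintegral_mono hpt

end Gain

/-! ### Suprema and infima of the density on small balls. -/

section BallExtrema

variable {E : Type*} [NormedAddCommGroup E]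

lemma BoundedBelowOnBalls.exists_pos_le {h : E → ℝ} (hb : BoundedBelowOnBalls h) (x : E) (ε : ℝ) :
    ∃ m : ℝ, 0 < m ∧ ∀ y ∈ Metric.ball x ε, m ≤ h y := by
  obtain ⟨c, hc, hch⟩ := hb (‖x‖ + |ε| + 1) (by positivity)
  refine ⟨c, hc, fun y hy => hch y ?_⟩
  rw [Metric.mem_ball] at hy
  rw [Metric.mem_closedBall]
  have := dist_triangle y x 0
  rw [dist_zero_right x] at this
  have := le_abs_self ε
  linarith

lemma BoundedBelowOnBalls.pos {h : E → ℝ} (hb : BoundedBelowOnBalls h) (x : E) : 0 < h x := by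
  obtain ⟨m, hm, hle⟩ := hb.exists_pos_le x 1
  exact hm.trans_le (hle x (Metric.mem_ball_self one_pos))

lemma ballSup_mono (h : E → ℝ) (x : E) : Monotone (ballSup h x) := fun _ _ hε =>
  biSup_mono fun _ hy => Metric.ball_subset_ball hε hy

lemma ballInf_anti (h : E → ℝ) (x : E) : Antitone (ballInf h x) := fun _ _ hε =>
  biInf_mono fun _ hy => Metric.ball_subset_ball hε hy

lemma le_ballSup (h : E → ℝ) {x y : E} {ε : ℝ} (hy : y ∈ Metric.ball x ε) :
    ENNReal.ofReal (h y) ≤ ballSup h x ε :=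
  le_iSup₂ (f := fun y (_ : y ∈ Metric.ball x ε) => ENNReal.ofReal (h y)) y hy

lemma ballInf_le (h : E → ℝ) {x y : E} {ε : ℝ} (hy : y ∈ Metric.ball x ε) :
    ballInf h x ε ≤ ENNReal.ofReal (h y) :=
  iInf₂_le (f := fun y (_ : y ∈ Metric.ball x ε) => ENNReal.ofReal (h y)) y hy

/-- The quotient is monotone in ε, so its one-sided limit exists in [0, ∞] without any regularity of
h. -/
lemma exists_tendsto_ballSup_div_ballInf (h : E → ℝ) (x : E) :
    ∃ L, Tendsto (fun ε : ℝ => ballSup h x ε / ballInf h x ε) (𝓝[>] 0) (𝓝 L) :=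
  ⟨_, Monotone.tendsto_nhdsGT (fun _ _ hε =>
    ENNReal.div_le_div (ballSup_mono h x hε) (ballInf_anti h x hε)) 0⟩

lemma exists_tendsto_ballInf_div_ballSup (h : E → ℝ) (x : E) :
    ∃ l, Tendsto (fun ε : ℝ => ballInf h x ε / ballSup h x ε) (𝓝[>] 0) (𝓝 l) :=
  ⟨_, Antitone.tendsto_nhdsGT (fun _ _ hε =>
    ENNReal.div_le_div (ballInf_anti h x hε) (ballSup_mono h x hε)) 0⟩

/-- Passes from extended to real bounds, where the integral estimates live. Positivity of the
infimum comes from the lower bound on bounded sets; an infinite supremum has to be treated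
separately. -/
lemma BoundedBelowOnBalls.exists_bounds {h : E → ℝ} (hb : BoundedBelowOnBalls h) {x : E} {ε : ℝ}
    (hε : 0 < ε) (hsup : ballSup h x ε ≠ ⊤) :
    ∃ m M : ℝ, 0 < m ∧ m ≤ M ∧ (∀ y ∈ Metric.ball x ε, m ≤ h y ∧ h y ≤ M) ∧
      ballInf h x ε = ENNReal.ofReal m ∧ ballSup h x ε = ENNReal.ofReal M := by
  have hx := Metric.mem_ball_self (x := x) hε
  have hinf : ballInf h x ε ≠ ⊤ := ((ballInf_le h hx).trans_lt ENNReal.ofReal_lt_top).ne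
  obtain ⟨m₀, hm₀, hle⟩ := hb.exists_pos_le x ε
  have hpos : ENNReal.ofReal m₀ ≤ ballInf h x ε :=
    le_iInf₂ fun y hy => ENNReal.ofReal_le_ofReal (hle y hy)
  have hm : 0 < (ballInf h x ε).toReal :=
    ENNReal.toReal_pos ((ENNReal.ofReal_pos.2 hm₀).trans_le hpos).ne' hinf
  refine ⟨(ballInf h x ε).toReal, (ballSup h x ε).toReal, hm,
    ENNReal.toReal_mono hsup ((ballInf_le h hx).trans (le_ballSup h hx)), fun y hy => ⟨?_, ?_⟩,
    (ENNReal.ofReal_toReal hinf).symm, (ENNReal.ofReal_toReal hsup).symm⟩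
  · exact ENNReal.toReal_le_of_le_ofReal (hb.pos y).le (ballInf_le h hy)
  · exact (ENNReal.ofReal_le_iff_le_toReal hsup).1 (le_ballSup h hy)

lemma tendsto_ballSup {h : E → ℝ} (hc : Continuous h) (x : E) :
    Tendsto (ballSup h x) (𝓝[>] 0) (𝓝 (ENNReal.ofReal (h x))) := by
  rw [tendsto_order]
  refine ⟨fun u hu => ?_, fun u hu => ?_⟩
  · filter_upwards [self_mem_nhdsWithin] with ε hε
    exact hu.trans_le (le_ballSup h (Metric.mem_ball_self hε))
  · obtain ⟨v, hv, hvu⟩ := exists_between hu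
    have : ∀ᶠ y in 𝓝 x, ENNReal.ofReal (h y) < v :=
      ((ENNReal.continuous_ofReal.comp hc).tendsto x).eventually_lt_const hv
    obtain ⟨δ, hδ, hball⟩ := Metric.eventually_nhds_iff_ball.1 this
    filter_upwards [Ioo_mem_nhdsGT hδ] with ε hε
    exact (iSup₂_le fun y hy => (hball y (Metric.ball_subset_ball hε.2.le hy)).le).trans_lt hvu

lemma tendsto_ballInf {h : E → ℝ} (hc : Continuous h) (x : E) :
    Tendsto (ballInf h x) (𝓝[>] 0) (𝓝 (ENNReal.ofReal (h x))) := by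
  rw [tendsto_order]
  refine ⟨fun u hu => ?_, fun u hu => ?_⟩
  · obtain ⟨v, huv, hv⟩ := exists_between hu
    have : ∀ᶠ y in 𝓝 x, v < ENNReal.ofReal (h y) :=
      ((ENNReal.continuous_ofReal.comp hc).tendsto x).eventually_const_lt hv
    obtain ⟨δ, hδ, hball⟩ := Metric.eventually_nhds_iff_ball.1 this
    filter_upwards [Ioo_mem_nhdsGT hδ] with ε hε
    exact huv.trans_le (le_iInf₂ fun y hy => (hball y (Metric.ball_subset_ball hε.2.le hy)).le)
  · filter_upwards [self_mem_nhdsWithin] with ε hε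
    exact (ballInf_le h (Metric.mem_ball_self hε)).trans_lt hu

end BallExtrema

/-- The scaling of the mass bound: n K^d is free of n for K = c n^{-1/d}. The next lemma does the
same for n^{1+r/d} K^{r+d}, the scaling of the inertia bound. -/
lemma natCast_mul_pow_rpow_neg {n d : ℕ} (hn : 1 ≤ n) (hd : 1 ≤ d) (c : ℝ) :
    (n : ℝ) * (c * (n : ℝ) ^ (-(1 / (d : ℝ)))) ^ d = c ^ d := by
  have hn0 : (0 : ℝ) < n := by exact_mod_cast hn
  have hd0 : (0 : ℝ) < d := by exact_mod_cast hd
  rw [mul_pow, ← Real.rpow_mul_natCast hn0.le, neg_mul, one_div_mul_cancel hd0.ne',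
    Real.rpow_neg_one]
  field_simp

lemma natCast_rpow_mul_rpow_neg {n d : ℕ} (hn : 1 ≤ n) (hd : 1 ≤ d) {c r : ℝ} (hc : 0 < c) :
    (n : ℝ) ^ (1 + r / (d : ℝ)) * (c * (n : ℝ) ^ (-(1 / (d : ℝ)))) ^ (r + (d : ℝ)) =
      c ^ (r + (d : ℝ)) := by
  have hn0 : (0 : ℝ) < n := by exact_mod_cast hn
  have hd0 : (0 : ℝ) < d := by exact_mod_cast hd
  rw [Real.mul_rpow hc.le (by positivity), ← Real.rpow_mul hn0.le, mul_left_comm,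
    ← Real.rpow_add hn0]
  have : 1 + r / (d : ℝ) + -(1 / (d : ℝ)) * (r + d) = 0 := by field_simp; ring
  rw [this, Real.rpow_zero, mul_one]

lemma natCast_rpow_eq_ofReal {n : ℕ} {p : ℝ} (hp : 0 ≤ p) :
    (n : ℝ≥0∞) ^ p = ENNReal.ofReal ((n : ℝ) ^ p) := by
  rw [← ENNReal.ofReal_natCast, ENNReal.ofReal_rpow_of_nonneg (by positivity) hp]

lemma le_liminf_natCast_mul {u : ℕ → ℝ≥0∞} {q : ℝ}
    (hu : ∀ᶠ n : ℕ in atTop, ENNReal.ofReal (q / n) ≤ u n) :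
    ENNReal.ofReal q ≤ liminf (fun n : ℕ => (n : ℝ≥0∞) * u n) atTop := by
  refine le_liminf_of_le (by isBoundedDefault) ?_
  filter_upwards [hu, eventually_ge_atTop 1] with n hn hn1
  have hn0 : (0 : ℝ) < n := by exact_mod_cast hn1
  refine le_trans (le_of_eq ?_) (mul_le_mul_right hn _)
  rw [← ENNReal.ofReal_natCast, ← ENNReal.ofReal_mul hn0.le, mul_div_cancel₀ _ hn0.ne']

lemma inertia_withDensity {E : Type*} [NormedAddCommGroup E] [MeasurableSpace E]
    [BorelSpace E] (lam : Measure E) {h : E → ℝ} (h_meas : Measurable h) (r : ℝ)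
    {W : Set E} (hW : MeasurableSet W) (a : E) :
    inertia (lam.withDensity fun x => ENNReal.ofReal (h x)) r W a =
      ∫⁻ y in W, edist y a ^ r * ENNReal.ofReal (h y) ∂lam := by
  rw [inertia, setLIntegral_withDensity_eq_setLIntegral_mul lam h_meas.ennreal_ofReal
    (by fun_prop) hW]
  simp_rw [Pi.mul_apply, mul_comm]

/-! ### Asymptotic bounds for the cells containing x, with m and M fixed. -/

section Asymptotics

variable {E : Type*} [NormedAddCommGroup E] [NormedSpace ℝ E]

/-- Under the sharpened micro-macro inequality, the Voronoi cells containing `x` shrink to `x`,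
with explicit radius if `m ≤ h` near `x`. -/
lemma SharpMicroMacro.eventually_cell [FiniteDimensional ℝ E] [Nontrivial E] {h : E → ℝ} {d : ℕ}
    (hd : 1 ≤ d) {r : ℝ} (hr : 0 < r) {α : ℕ → Finset E} {c : ℝ} (hc : 0 < c)
    (hα : SharpMicroMacro h d r α c) {x : E} {a : ℕ → E}
    (ha : ∀ n : ℕ, 1 ≤ n → a n ∈ α n ∧ x ∈ voronoiCell (a n) (α n))
    {m : ℝ} (hm : 0 < m) (hle : ∀ᶠ y in 𝓝[≠] x, m ≤ h y) {ε : ℝ} (hε : 0 < ε) :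
    ∀ᶠ n : ℕ in atTop,
      voronoiCell (a n) (α n) ⊆ Metric.ball x ε ∧
      voronoiCell (a n) (α n) ⊆ Metric.closedBall (a n)
        (c * (n : ℝ) ^ (-(1 / (d : ℝ))) * m ^ (-(1 / (r + (d : ℝ))))) ∧
      (∀ y ∈ openVoronoiCell (a n) (α n), Metric.infEDist y ((α n : Set E) \ {a n}) ≤
        ENNReal.ofReal (4 * (c * (n : ℝ) ^ (-(1 / (d : ℝ))) * m ^ (-(1 / (r + (d : ℝ))))))) ∧
      ∀ y ∈ voronoiCell (a n) (α n), 0 < h y →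
        ‖y - a n‖ ≤ c * (n : ℝ) ^ (-(1 / (d : ℝ))) * h y ^ (-(1 / (r + (d : ℝ)))) := by
  have hd0 : (0 : ℝ) < d := by exact_mod_cast hd
  have : (𝓝[≠] x).NeBot := Module.punctured_nhds_neBot ℝ E x
  obtain ⟨δ, hδ, hball⟩ := Metric.eventually_nhds_iff_ball.1 (eventually_nhdsWithin_iff.1 hle)
  set η := min δ ε with hη_def
  have hη : 0 < η := lt_min hδ hε
  obtain ⟨N, hN⟩ := hα (Metric.closedBall x η) (isCompact_closedBall x η)
  have hlim : Tendsto (fun n : ℕ => c * (n : ℝ) ^ (-(1 / (d : ℝ))) * m ^ (-(1 / (r + (d : ℝ)))))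
      atTop (𝓝 0) := by
    have := ((tendsto_rpow_neg_atTop (y := 1 / (d : ℝ)) (by positivity)).comp
      tendsto_natCast_atTop_atTop).const_mul c |>.mul_const (m ^ (-(1 / (r + (d : ℝ)))))
    simpa [Function.comp_def] using this
  -- R < η/4 gives both 3R < η, needed by the cell lemmas, and 2R < η, which keeps the cell inside
  -- the ball about x.
  filter_upwards [eventually_ge_atTop N, eventually_ge_atTop 1,
    hlim.eventually_lt_const (show 0 < η / 4 by positivity)] with n hnN hn1 hRn
  obtain ⟨han, hxn⟩ := ha n hn1
  have hn0 : (0 : ℝ) < n := by exact_mod_cast hn1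
  set R := c * (n : ℝ) ^ (-(1 / (d : ℝ))) * m ^ (-(1 / (r + (d : ℝ)))) with hR_def
  have hR : 0 < R := by positivity
  have hne : ∀ y ∈ Metric.ball x η, y ≠ x → Metric.infEDist y (α n : Set E) ≤ ENNReal.ofReal R := by
    intro y hy hyx
    refine (hN n hnN y (Metric.ball_subset_closedBall hy)).trans (ENNReal.ofReal_le_ofReal ?_)
    refine mul_le_mul_of_nonneg_left (Real.rpow_le_rpow_of_nonpos hm
      (hball y (Metric.ball_subset_ball (min_le_left _ _) hy) hyx) ?_) (by positivity)
    rw [neg_nonpos]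
    positivity
  -- The lower bound m is not assumed at x itself; there the estimate follows from its neighbours by
  -- continuity of the distance.
  have hall : ∀ y ∈ Metric.ball x η, Metric.infEDist y (α n : Set E) ≤ ENNReal.ofReal R := by
    intro y hy
    rcases eq_or_ne y x with rfl | hyx
    · refine le_of_tendsto ((Metric.continuous_infEDist (s := (α n : Set E))).continuousAt.mono_left
        (nhdsWithin_le_nhds (s := {y}ᶜ))) ?_
      filter_upwards [self_mem_nhdsWithin, nhdsWithin_le_nhds (Metric.ball_mem_nhds y hη)]
        with z hz hzb using hne z hzb hz
    · exact hne y hy hyx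
  have h3 : 3 * R < η := by linarith
  have hsub := voronoiCell_subset_closedBall hR h3 hall hxn
  have hsubη : voronoiCell (a n) (α n) ⊆ Metric.ball x η := fun y hy => by
    have h1 : dist y (a n) ≤ R := hsub hy
    have h2 : dist x (a n) ≤ R := hsub hxn
    rw [Metric.mem_ball]
    have := dist_triangle_right y x (a n)
    linarith
  refine ⟨hsubη.trans (Metric.ball_subset_ball (min_le_right _ _)), hsub,
    fun y hy => infEDist_sdiff_le hR h3 han hall hxn hy, fun y hy hpos => ?_⟩
  have h1 := hN n hnN y (Metric.ball_subset_closedBall (hsubη hy))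
  have h2 : edist y (a n) = Metric.infEDist y (α n : Set E) := hy
  rwa [← h2, edist_dist, dist_eq_norm, ENNReal.ofReal_le_ofReal_iff (by positivity)] at h1

variable [MeasurableSpace E] [BorelSpace E]

variable [FiniteDimensional ℝ E] [Nontrivial E]

/-- Bounds that hold in a punctured neighbourhood hold almost everywhere on small sets. -/
lemma exists_ball_forall_ae_of_eventually {lam : Measure E} [lam.IsAddHaarMeasure]
    {h : E → ℝ} {x : E} {M : ℝ} (hle : ∀ᶠ y in 𝓝[≠] x, h y ≤ M) :
    ∃ ε > 0, ∀ W ⊆ Metric.ball x ε, ∀ᵐ y ∂lam, y ∈ W → h y ≤ M := by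
  obtain ⟨ε, hε, hball⟩ := Metric.eventually_nhds_iff_ball.1 (eventually_nhdsWithin_iff.1 hle)
  refine ⟨ε, hε, fun W hW => ?_⟩
  have : ∀ᵐ y ∂lam, y ≠ x := by
    rw [ae_iff]; simp
  filter_upwards [this] with y hy hyW using hball y (hW hyW) hy

variable (lam : Measure E) {h : E → ℝ} {r c : ℝ} {α : ℕ → Finset E} {x : E} {a : ℕ → E}

/-- The mass of the open Voronoi cells of an optimal codebook is at least of order `1 / n`,
given that removing a point costs at least `g n^{-(1+r/d)}`. -/
lemma eventually_le_mass (hr : 0 < r) (hc : 0 < c)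
    [IsProbabilityMeasure (lam.withDensity fun x => ENNReal.ofReal (h x))]
    (h_moment : ∃ δ : ℝ, 0 < δ ∧
      ∫⁻ x, ‖x‖ₑ ^ (r + δ) ∂(lam.withDensity fun x => ENNReal.ofReal (h x)) < ⊤)
    {g : ℝ} (hg : 0 < g)
    (hgain : ∀ n : ℕ, 1 ≤ n →
      errorPow (lam.withDensity fun x => ENNReal.ofReal (h x)) r (n + 1) +
          ENNReal.ofReal (g * (n : ℝ) ^ (-(1 + r / (Module.finrank ℝ E : ℝ)))) ≤
        errorPow (lam.withDensity fun x => ENNReal.ofReal (h x)) r n)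
    (hopt : ∀ n : ℕ, 1 ≤ n →
      IsOptimalCodebook (lam.withDensity fun x => ENNReal.ofReal (h x)) r n (α n))
    (hα : SharpMicroMacro h (Module.finrank ℝ E) r α c)
    (ha : ∀ n : ℕ, 1 ≤ n → a n ∈ α n ∧ x ∈ voronoiCell (a n) (α n))
    {m : ℝ} (hm : 0 < m) (hmle : ∀ᶠ y in 𝓝[≠] x, m ≤ h y) :
    ∀ᶠ n : ℕ in atTop,
      ENNReal.ofReal (g * (4 * c) ^ (-r) * m ^ (r / (r + (Module.finrank ℝ E : ℝ))) / n) ≤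
        (lam.withDensity fun x => ENNReal.ofReal (h x)) (openVoronoiCell (a n) (α n)) := by
  classical
  have hd : 1 ≤ Module.finrank ℝ E := Module.finrank_pos
  have hd0 : (0 : ℝ) < Module.finrank ℝ E := by exact_mod_cast hd
  set P := lam.withDensity fun x => ENNReal.ofReal (h x)
  filter_upwards [hα.eventually_cell hd hr hc ha hm hmle one_pos, eventually_ge_atTop 2]
    with n ⟨_, _, hsecond, _⟩ hn
  -- The deleted codebook competes at level k = n - 1, and n ≥ 2 gives the k ≥ 1 that `hgain`
  -- requires.
  obtain ⟨k, rfl⟩ : ∃ k, n = k + 1 := ⟨n - 1, by omega⟩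
  have hk0 : (0 : ℝ) < k := by exact_mod_cast (show 0 < k by omega)
  obtain ⟨han, -⟩ := ha (k + 1) (by omega)
  obtain ⟨hcard, hdist⟩ := hopt (k + 1) (by omega)
  set N : ℝ := ((k + 1 : ℕ) : ℝ) with hN_def
  have hN : 0 < N := by positivity
  set R := 4 * (c * N ^ (-(1 / (Module.finrank ℝ E : ℝ))) *
    m ^ (-(1 / (r + (Module.finrank ℝ E : ℝ))))) with hR_def
  have hR : 0 < R := by positivity
  have h1 := distortion_erase_le P hr hR.le han hsecond
  have h2 : errorPow P r k ≤ distortion P r ((α (k + 1)).erase (a (k + 1)) : Set E) :=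
    errorPow_le_distortion P r (by rw [Finset.card_erase_of_mem han]; omega)
  -- With e_n denoting `errorPow` at level n: e_{k+1} + gain ≤ e_k ≤ distortion after deletion ≤
  -- e_{k+1} + R^r P(W₀). Cancelling the finite e_{k+1} isolates the mass of the open cell.
  have h3 := ((hgain k (by omega)).trans h2).trans h1
  rw [hdist, ENNReal.add_le_add_iff_left (errorPow_ne_top P hr h_moment (by omega))] at h3
  have h4 : g * N ^ (-(1 + r / (Module.finrank ℝ E : ℝ))) ≤
      g * (k : ℝ) ^ (-(1 + r / (Module.finrank ℝ E : ℝ))) := by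
    refine mul_le_mul_of_nonneg_left (Real.rpow_le_rpow_of_nonpos hk0 ?_ ?_) hg.le
    · rw [hN_def]; push_cast; linarith
    · rw [neg_nonpos]; positivity
  have h5 := (ENNReal.ofReal_le_ofReal h4).trans h3
  have hRr : 0 < R ^ r := Real.rpow_pos_of_pos hR r
  have h6 : g * N ^ (-(1 + r / (Module.finrank ℝ E : ℝ))) =
      R ^ r * (g * (4 * c) ^ (-r) * m ^ (r / (r + (Module.finrank ℝ E : ℝ))) / N) := by
    have e : R ^ r = (4 * c) ^ r * N ^ (-(r / (Module.finrank ℝ E : ℝ))) *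
        (m ^ (r / (r + (Module.finrank ℝ E : ℝ))))⁻¹ := by
      rw [hR_def, ← Real.rpow_neg hm.le, ← mul_assoc, ← mul_assoc,
        Real.mul_rpow (by positivity) (by positivity),
        Real.mul_rpow (by positivity) (by positivity), ← Real.rpow_mul hN.le,
        ← Real.rpow_mul hm.le]
      congr 3 <;> ring
    have e2 : N ^ (-(1 + r / (Module.finrank ℝ E : ℝ))) =
        N ^ (-(r / (Module.finrank ℝ E : ℝ))) / N := by
      rw [← Real.rpow_sub_one hN.ne']
      congr 1
      ring
    have p1 : 0 < (4 * c) ^ r := by positivity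
    have p2 : 0 < m ^ (r / (r + (Module.finrank ℝ E : ℝ))) := by positivity
    rw [e, e2]
    field_simp
    rw [← Real.rpow_add (by positivity), add_neg_cancel, Real.rpow_zero]
  rw [h6, ENNReal.ofReal_mul hRr.le] at h5
  exact (ENNReal.mul_le_mul_iff_right (ENNReal.ofReal_pos.2 hRr).ne' ENNReal.ofReal_ne_top).1 h5

variable [lam.IsAddHaarMeasure]

lemma limsup_mass_le (hb : BoundedBelowOnBalls h) (hr : 0 < r) (hc : 0 < c)
    (hα : SharpMicroMacro h (Module.finrank ℝ E) r α c)
    (ha : ∀ n : ℕ, 1 ≤ n → a n ∈ α n ∧ x ∈ voronoiCell (a n) (α n))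
    {M : ℝ} (hM : 0 < M) (hle : ∀ᶠ y in 𝓝[≠] x, h y ≤ M) :
    limsup (fun n : ℕ => (n : ℝ≥0∞) *
        (lam.withDensity fun x => ENNReal.ofReal (h x)) (voronoiCell (a n) (α n))) atTop ≤
      ENNReal.ofReal (lam.real (Metric.ball (0 : E) 1) * (1 + Module.finrank ℝ E / r) *
        c ^ Module.finrank ℝ E * M ^ (r / (r + (Module.finrank ℝ E : ℝ)))) := by
  have hd : 1 ≤ Module.finrank ℝ E := Module.finrank_pos
  -- Any positive lower bound will do: it only makes the cells shrink and does not enter the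
  -- estimate.
  obtain ⟨m, hm, hmle⟩ := hb.exists_pos_le x 1
  have hmle' : ∀ᶠ y in 𝓝[≠] x, m ≤ h y :=
    nhdsWithin_le_nhds (eventually_of_mem (Metric.ball_mem_nhds x one_pos) hmle)
  obtain ⟨ε, hε, hae⟩ := exists_ball_forall_ae_of_eventually (lam := lam) hle
  refine limsup_le_of_le (by isBoundedDefault) ?_
  filter_upwards [hα.eventually_cell hd hr hc ha hm hmle' hε, eventually_ge_atTop 1]
    with n ⟨hball, _, _, hdist⟩ hn
  have hn0 : (0 : ℝ) < n := by exact_mod_cast hn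
  have hW := (isClosed_voronoiCell (a n) (α n)).measurableSet
  rw [withDensity_apply _ hW]
  refine (mul_le_mul_right (setLIntegral_density_le lam hW hM (by positivity) hr (hae _ hball)
    (a n) fun y hy => ⟨hb.pos y, hdist y hy (hb.pos y)⟩) _).trans (le_of_eq ?_)
  rw [← ENNReal.ofReal_natCast, ← ENNReal.ofReal_mul hn0.le]
  congr 1
  rw [← natCast_mul_pow_rpow_neg hn hd c]
  ring

lemma limsup_inertia_le (h_meas : Measurable h) (hb : BoundedBelowOnBalls h) (hr : 0 < r)
    (hc : 0 < c) (hα : SharpMicroMacro h (Module.finrank ℝ E) r α c)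
    (ha : ∀ n : ℕ, 1 ≤ n → a n ∈ α n ∧ x ∈ voronoiCell (a n) (α n))
    {m M : ℝ} (hm : 0 < m) (hmM : m ≤ M) (hmle : ∀ᶠ y in 𝓝[≠] x, m ≤ h y)
    (hle : ∀ᶠ y in 𝓝[≠] x, h y ≤ M) :
    limsup (fun n : ℕ => (n : ℝ≥0∞) ^ (1 + r / (Module.finrank ℝ E : ℝ)) *
        inertia (lam.withDensity fun x => ENNReal.ofReal (h x)) r
          (voronoiCell (a n) (α n)) (a n)) atTop ≤
      ENNReal.ofReal (lam.real (Metric.ball (0 : E) 1) * c ^ (r + (Module.finrank ℝ E : ℝ)) *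
        (1 + Real.log (M / m))) := by
  have hd : 1 ≤ Module.finrank ℝ E := Module.finrank_pos
  obtain ⟨ε, hε, hae⟩ := exists_ball_forall_ae_of_eventually (lam := lam) hle
  refine limsup_le_of_le (by isBoundedDefault) ?_
  filter_upwards [hα.eventually_cell hd hr hc ha hm hmle hε, eventually_ge_atTop 1]
    with n ⟨hball, hsub, _, hdist⟩ hn
  have hn0 : (0 : ℝ) < n := by exact_mod_cast hn
  have hW := (isClosed_voronoiCell (a n) (α n)).measurableSet
  rw [inertia_withDensity lam h_meas r hW]
  refine (mul_le_mul_right (setLIntegral_inertia_le lam hW hm hmM (by positivity) hr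
    (hae _ hball) (a n) (fun y hy => ⟨hb.pos y, hdist y hy (hb.pos y)⟩) hsub) _).trans
    (le_of_eq ?_)
  rw [natCast_rpow_eq_ofReal (by positivity), ← ENNReal.ofReal_mul (by positivity)]
  congr 1
  rw [← natCast_rpow_mul_rpow_neg hn hd hc (r := r)]
  ring

lemma le_liminf_inertia (h_meas : Measurable h) (hr : 0 < r) (hc : 0 < c)
    (hα : SharpMicroMacro h (Module.finrank ℝ E) r α c)
    (ha : ∀ n : ℕ, 1 ≤ n → a n ∈ α n ∧ x ∈ voronoiCell (a n) (α n))
    {G m M : ℝ} (hG : 0 < G) (hm : 0 < m) (hM : 0 < M) (hmle : ∀ᶠ y in 𝓝[≠] x, m ≤ h y)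
    (hle : ∀ᶠ y in 𝓝[≠] x, h y ≤ M)
    (hmass : ∀ᶠ n : ℕ in atTop,
      ENNReal.ofReal (G * m ^ (r / (r + (Module.finrank ℝ E : ℝ))) / n) ≤
        (lam.withDensity fun x => ENNReal.ofReal (h x)) (openVoronoiCell (a n) (α n))) :
    ENNReal.ofReal ((G / (2 * lam.real (Metric.ball (0 : E) 1))) ^
        (r / (Module.finrank ℝ E : ℝ)) * (G / 2) * (m / M) ^ (r / (Module.finrank ℝ E : ℝ))) ≤
      liminf (fun n : ℕ => (n : ℝ≥0∞) ^ (1 + r / (Module.finrank ℝ E : ℝ)) *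
        inertia (lam.withDensity fun x => ENNReal.ofReal (h x)) r
          (openVoronoiCell (a n) (α n)) (a n)) atTop := by
  have hd : 1 ≤ Module.finrank ℝ E := Module.finrank_pos
  have hd0 : (0 : ℝ) < Module.finrank ℝ E := by exact_mod_cast hd
  have hV := measure_unitBall_real_pos lam
  set V := lam.real (Metric.ball (0 : E) 1) with hV_def
  obtain ⟨ε, hε, hae⟩ := exists_ball_forall_ae_of_eventually (lam := lam) hle
  refine le_liminf_of_le (by isBoundedDefault) ?_
  filter_upwards [hα.eventually_cell hd hr hc ha hm hmle hε, hmass, eventually_ge_atTop 1]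
    with n ⟨hball, _, _, _⟩ hn hn1
  have hn0 : (0 : ℝ) < n := by exact_mod_cast hn1
  have hW := (isOpen_openVoronoiCell (a n) (α n)).measurableSet
  rw [inertia_withDensity lam h_meas r hW]
  rw [withDensity_apply _ hW] at hn
  refine le_trans (le_of_eq ?_) (mul_le_mul_right (le_setLIntegral_inertia lam hW hM
    (by positivity) hr (hae _ ((openVoronoiCell_subset (ha n hn1).1).trans hball)) (a n) hn) _)
  rw [natCast_rpow_eq_ofReal (by positivity), ← ENNReal.ofReal_mul (by positivity), ← hV_def]
  congr 1
  set e := r / (Module.finrank ℝ E : ℝ) with he_def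
  have e1 : G * m ^ (r / (r + (Module.finrank ℝ E : ℝ))) / n / (2 * M * V) =
      G / (2 * V) * (m ^ (r / (r + (Module.finrank ℝ E : ℝ))) / M) * (n : ℝ)⁻¹ := by
    field_simp
  -- The powers of m combine because (r/(r+d)) (1 + r/d) = r/d.
  have e2 : (m / M) ^ e = (m ^ (r / (r + (Module.finrank ℝ E : ℝ))) / M) ^ e *
      m ^ (r / (r + (Module.finrank ℝ E : ℝ))) := by
    rw [Real.div_rpow hm.le hM.le, Real.div_rpow (by positivity) hM.le, ← Real.rpow_mul hm.le,
      div_mul_eq_mul_div, ← Real.rpow_add hm]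
    congr 2
    rw [he_def]
    field_simp
  have e3 : (n : ℝ) ^ (1 + e) * ((n : ℝ)⁻¹) ^ e * (n : ℝ)⁻¹ = 1 := by
    rw [Real.rpow_add hn0, Real.inv_rpow hn0.le, Real.rpow_one]
    have := Real.rpow_pos_of_pos hn0 e
    field_simp
  rw [e1, e2, Real.mul_rpow (by positivity) (by positivity),
    Real.mul_rpow (by positivity) (by positivity)]
  calc _ = (G / (2 * V)) ^ e * (G / 2) * ((m ^ (r / (r + (Module.finrank ℝ E : ℝ))) / M) ^ e *
        m ^ (r / (r + (Module.finrank ℝ E : ℝ)))) *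
        ((n : ℝ) ^ (1 + e) * ((n : ℝ)⁻¹) ^ e * (n : ℝ)⁻¹) := by rw [e3, mul_one]
    _ = _ := by ring

end Asymptotics

/-! ### Limits in the bounds m and M. -/

/-- Passing to the limit from above in a family of power bounds. -/
lemma le_ofReal_mul_rpow_of_forall_gt {T s : ℝ≥0∞} {C q : ℝ} (hC : 0 < C) (hq : 0 < q)
    (H : ∀ M : ℝ, 0 < M → s < ENNReal.ofReal M → T ≤ ENNReal.ofReal (C * M ^ q)) :
    T ≤ ENNReal.ofReal C * s ^ q := by
  rcases eq_or_ne s ⊤ with rfl | hs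
  · rw [ENNReal.top_rpow_of_pos hq, ENNReal.mul_top (ENNReal.ofReal_pos.2 hC).ne']
    exact le_top
  · have hs' : s < ⊤ := lt_top_iff_ne_top.2 hs
    have : (𝓝[>] s).NeBot := nhdsGT_neBot_of_exists_gt ⟨⊤, hs'⟩
    have hlim : Tendsto (fun u : ℝ≥0∞ => ENNReal.ofReal C * u ^ q) (𝓝[>] s)
        (𝓝 (ENNReal.ofReal C * s ^ q)) :=
      (ENNReal.Tendsto.const_mul (ENNReal.continuous_rpow_const.tendsto s)
        (Or.inr ENNReal.ofReal_ne_top)).mono_left nhdsWithin_le_nhds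
    refine ge_of_tendsto hlim ?_
    filter_upwards [Ioo_mem_nhdsGT hs'] with u hu
    have hu0 : 0 < u.toReal := ENNReal.toReal_pos (pos_of_gt hu.1).ne' hu.2.ne
    have hu1 : ENNReal.ofReal u.toReal = u := ENNReal.ofReal_toReal hu.2.ne
    refine (H u.toReal hu0 (hu1.symm ▸ hu.1)).trans (le_of_eq ?_)
    rw [ENNReal.ofReal_mul hC.le, ← ENNReal.ofReal_rpow_of_pos hu0, hu1]

/-- Passing to the limit from below in a family of power bounds. -/
lemma ofReal_mul_rpow_le_of_forall_lt {T s : ℝ≥0∞} {C q : ℝ} (hC : 0 < C) (hq : 0 < q)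
    (H : ∀ m : ℝ, 0 < m → ENNReal.ofReal m < s → ENNReal.ofReal (C * m ^ q) ≤ T) :
    ENNReal.ofReal C * s ^ q ≤ T := by
  rcases eq_or_ne s 0 with rfl | hs
  · simp [ENNReal.zero_rpow_of_pos hq]
  · have hs' : 0 < s := pos_iff_ne_zero.2 hs
    have : (𝓝[<] s).NeBot := nhdsLT_neBot_of_exists_lt ⟨0, hs'⟩
    have hlim : Tendsto (fun u : ℝ≥0∞ => ENNReal.ofReal C * u ^ q) (𝓝[<] s)
        (𝓝 (ENNReal.ofReal C * s ^ q)) :=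
      (ENNReal.Tendsto.const_mul (ENNReal.continuous_rpow_const.tendsto s)
        (Or.inr ENNReal.ofReal_ne_top)).mono_left nhdsWithin_le_nhds
    refine le_of_tendsto hlim ?_
    filter_upwards [Ioo_mem_nhdsLT hs'] with u hu
    have hut : u ≠ ⊤ := hu.2.ne_top
    have hu0 : 0 < u.toReal := ENNReal.toReal_pos hu.1.ne' hut
    have hu1 : ENNReal.ofReal u.toReal = u := ENNReal.ofReal_toReal hut
    refine le_trans (le_of_eq ?_) (H u.toReal hu0 (hu1.symm ▸ hu.2))
    rw [ENNReal.ofReal_mul hC.le, ← ENNReal.ofReal_rpow_of_pos hu0, hu1]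

section Ratios

variable {E : Type*} [NormedAddCommGroup E] {h : E → ℝ}

/-- Passing to the limit in a family of logarithmic upper bounds. -/
lemma BoundedBelowOnBalls.coe_le_mul_one_add_log (hb : BoundedBelowOnBalls h) {x : E}
    {T L : ℝ≥0∞} {C : ℝ} (hC : 0 < C)
    (hL : Tendsto (fun ε : ℝ => ballSup h x ε / ballInf h x ε) (𝓝[>] 0) (𝓝 L))
    (H : ∀ ε m M : ℝ, 0 < ε → 0 < m → m ≤ M → (∀ y ∈ Metric.ball x ε, m ≤ h y ∧ h y ≤ M) →
      T ≤ ENNReal.ofReal (C * (1 + Real.log (M / m)))) :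
    (T : EReal) ≤ (C : EReal) * (1 + ENNReal.log L) := by
  rcases eq_or_ne L ⊤ with rfl | hLt
  · rw [ENNReal.log_top,
      show (1 : EReal) + ⊤ = ⊤ from EReal.add_top_of_ne_bot (EReal.coe_ne_bot 1),
      EReal.coe_mul_top_of_pos hC]
    exact le_top
  have hfin : ∀ᶠ ε : ℝ in 𝓝[>] 0, ∃ m M : ℝ, 0 < m ∧ m ≤ M ∧
      (∀ y ∈ Metric.ball x ε, m ≤ h y ∧ h y ≤ M) ∧
      (ballSup h x ε / ballInf h x ε).toReal = M / m := by
    filter_upwards [hL.eventually_lt_const (lt_top_iff_ne_top.2 hLt), self_mem_nhdsWithin]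
      with ε hε hε0
    -- The infimum is finite, so an infinite supremum would make the quotient infinite, contrary to
    -- its finite limit.
    have hsup : ballSup h x ε ≠ ⊤ := by
      intro htop
      have hinf : ballInf h x ε ≠ ⊤ :=
        ((ballInf_le h (Metric.mem_ball_self hε0)).trans_lt ENNReal.ofReal_lt_top).ne
      rw [htop, ENNReal.top_div_of_ne_top hinf] at hε
      exact hε.ne rfl
    obtain ⟨m, M, hm, hmM, hbd, hI, hS⟩ := hb.exists_bounds hε0 hsup
    refine ⟨m, M, hm, hmM, hbd, ?_⟩
    rw [hI, hS, ENNReal.toReal_div, ENNReal.toReal_ofReal hm.le,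
      ENNReal.toReal_ofReal (hm.le.trans hmM)]
  have hreal := (ENNReal.tendsto_toReal hLt).comp hL
  -- Besides continuity of the logarithm at the limit, this gives a nonnegative bound, so
  -- `ENNReal.ofReal` loses nothing when passing to `EReal`.
  have hL1 : 1 ≤ L.toReal := by
    refine ge_of_tendsto hreal ?_
    filter_upwards [hfin] with ε ⟨m, M, hm, hmM, _, he⟩
    rw [Function.comp_apply, he]
    exact (one_le_div hm).2 hmM
  have hT : T ≤ ENNReal.ofReal (C * (1 + Real.log L.toReal)) := by
    refine ge_of_tendsto (ENNReal.tendsto_ofReal (((hreal.log (by positivity)).const_add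
      1).const_mul C)) ?_
    filter_upwards [hfin, self_mem_nhdsWithin] with ε ⟨m, M, hm, hmM, hbd, he⟩ hε0
    rw [Function.comp_apply, he]
    exact H ε m M hε0 hm hmM hbd
  have hlog := Real.log_nonneg hL1
  have hcoe : (T : EReal) ≤ (ENNReal.ofReal (C * (1 + Real.log L.toReal)) : EReal) := by
    exact_mod_cast hT
  refine hcoe.trans (le_of_eq ?_)
  rw [EReal.coe_ennreal_ofReal, max_eq_left (by positivity),
    ENNReal.log_pos_real' (by linarith)]
  push_cast
  rfl

/-- Passing to the limit in a family of lower bounds by a power of the oscillation. -/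
lemma BoundedBelowOnBalls.mul_rpow_le (hb : BoundedBelowOnBalls h) {x : E}
    {T l : ℝ≥0∞} {C p q : ℝ} (hC : 0 < C) (hp : 0 < p) (hqp : q ≤ p)
    (hl : Tendsto (fun ε : ℝ => ballInf h x ε / ballSup h x ε) (𝓝[>] 0) (𝓝 l))
    (H : ∀ ε m M : ℝ, 0 < ε → 0 < m → m ≤ M → (∀ y ∈ Metric.ball x ε, m ≤ h y ∧ h y ≤ M) →
      ENNReal.ofReal (C * (m / M) ^ q) ≤ T) :
    ENNReal.ofReal C * l ^ p ≤ T := by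
  have hlim : Tendsto (fun ε : ℝ => ENNReal.ofReal C * (ballInf h x ε / ballSup h x ε) ^ p)
      (𝓝[>] 0) (𝓝 (ENNReal.ofReal C * l ^ p)) :=
    ENNReal.Tendsto.const_mul ((ENNReal.continuous_rpow_const.tendsto l).comp hl)
      (Or.inr ENNReal.ofReal_ne_top)
  refine le_of_tendsto hlim ?_
  filter_upwards [self_mem_nhdsWithin] with ε hε0
  rcases eq_or_ne (ballSup h x ε) ⊤ with htop | hsup
  · simp [htop, ENNReal.zero_rpow_of_pos hp]
  · obtain ⟨m, M, hm, hmM, hbd, hI, hS⟩ := hb.exists_bounds hε0 hsup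
    have hM : 0 < M := hm.trans_le hmM
    refine le_trans ?_ (H ε m M hε0 hm hmM hbd)
    rw [hI, hS, ← ENNReal.ofReal_div_of_pos hM, ENNReal.ofReal_rpow_of_pos (by positivity),
      ← ENNReal.ofReal_mul hC.le]
    refine ENNReal.ofReal_le_ofReal (mul_le_mul_of_nonneg_left ?_ hC.le)
    -- Since m/M ≤ 1, enlarging the exponent only weakens the bound.
    exact Real.rpow_le_rpow_of_exponent_ge (by positivity) ((div_le_one hM).2 hmM) hqp

end Ratios

end Quantization

/-! ### Choice of constants and assembly. -/

theorem corollary4p10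
    {E : Type*} [NormedAddCommGroup E] [NormedSpace ℝ E] [FiniteDimensional ℝ E]
    [MeasurableSpace E] [BorelSpace E]
    (d : ℕ) (hd : 1 ≤ d) (hE : Module.finrank ℝ E = d)
    (lam : Measure E) [lam.IsAddHaarMeasure]
    (P : Measure E) [IsProbabilityMeasure P]
    (h : E → ℝ) (h_meas : Measurable h)
    (hP : P = lam.withDensity fun x => ENNReal.ofReal (h x))
    (h_below : Quantization.BoundedBelowOnBalls h)
    (r : ℝ) (hr : 0 < r)
    (h_moment : ∃ δ : ℝ, 0 < δ ∧ ∫⁻ x, ‖x‖ₑ ^ (r + δ) ∂P < ⊤)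
    (c₂₁ : ℝ) (hc₂₁ : 0 < c₂₁) :
    (∃ c₂₂ c₂₃ c₂₄ c₂₅ : ℝ, 0 < c₂₂ ∧ 0 < c₂₃ ∧ 0 < c₂₄ ∧ 0 < c₂₅ ∧
      ∀ α : ℕ → Finset E,
        (∀ n : ℕ, 1 ≤ n → Quantization.IsOptimalCodebook P r n (α n)) →
        Quantization.SharpMicroMacro h d r α c₂₁ →
        ∀ (x : E) (a : ℕ → E),
          (∀ n : ℕ, 1 ≤ n → a n ∈ α n ∧ x ∈ Quantization.voronoiCell (a n) (α n)) →
          -- upper bound for the cell probabilities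
          limsup (fun n : ℕ => (n : ℝ≥0∞) * P (Quantization.voronoiCell (a n) (α n))) atTop
              ≤ ENNReal.ofReal c₂₂ *
                (limsup (fun y => ENNReal.ofReal (h y)) (𝓝[≠] x)) ^ (r / (r + (d : ℝ))) ∧
          -- upper bound for the local inertias
          (∃ L : ℝ≥0∞,
            Tendsto (fun ε : ℝ => Quantization.ballSup h x ε / Quantization.ballInf h x ε)
              (𝓝[>] 0) (𝓝 L) ∧
            ((limsup (fun n : ℕ => (n : ℝ≥0∞) ^ (1 + r / (d : ℝ)) *
                Quantization.inertia P r (Quantization.voronoiCell (a n) (α n)) (a n)) atTop :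
                  ℝ≥0∞) : EReal)
              ≤ (c₂₃ : EReal) * (1 + ENNReal.log L)) ∧
          -- lower bound for the open cell probabilities
          ENNReal.ofReal c₂₄ *
                (liminf (fun y => ENNReal.ofReal (h y)) (𝓝[≠] x)) ^ (r / (r + (d : ℝ)))
              ≤ liminf (fun n : ℕ =>
                  (n : ℝ≥0∞) * P (Quantization.openVoronoiCell (a n) (α n))) atTop ∧
          -- lower bound for the local inertias
          (∃ l : ℝ≥0∞,
            Tendsto (fun ε : ℝ => Quantization.ballInf h x ε / Quantization.ballSup h x ε)
              (𝓝[>] 0) (𝓝 l) ∧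
            ENNReal.ofReal c₂₅ * l ^ max 1 r
              ≤ liminf (fun n : ℕ => (n : ℝ≥0∞) ^ (1 + r / (d : ℝ)) *
                  Quantization.inertia P r
                    (Quantization.openVoronoiCell (a n) (α n)) (a n)) atTop)) ∧
    (Continuous h → ∀ x : E,
      limsup (fun y => ENNReal.ofReal (h y)) (𝓝[≠] x) = ENNReal.ofReal (h x) ∧
      liminf (fun y => ENNReal.ofReal (h y)) (𝓝[≠] x) = ENNReal.ofReal (h x) ∧
      Tendsto (fun ε : ℝ => Quantization.ballSup h x ε / Quantization.ballInf h x ε)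
        (𝓝[>] 0) (𝓝 1) ∧
      Tendsto (fun ε : ℝ => Quantization.ballInf h x ε / Quantization.ballSup h x ε)
        (𝓝[>] 0) (𝓝 1)) := by
  subst hE hP
  have : Nontrivial E := Module.finrank_pos_iff.1 (show 0 < Module.finrank ℝ E by omega)
  have hd0 : (0 : ℝ) < Module.finrank ℝ E := by exact_mod_cast hd
  have hV := Quantization.measure_unitBall_real_pos lam
  have hq : 0 < r / (r + (Module.finrank ℝ E : ℝ)) := by positivity
  have hball : ∀ (x : E) (ε : ℝ), 0 < ε → Metric.ball x ε ∈ 𝓝[≠] x := fun x ε hε =>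
    nhdsWithin_le_nhds (Metric.ball_mem_nhds x hε)
  refine ⟨?_, fun hcont x => ?_⟩
  · obtain ⟨g, hg, hgain⟩ := Quantization.exists_errorPow_succ_add_le lam h_below hr
    -- The constant of the mass bound: the gain g over the deletion cost (4 c₂₁)^r. It is fixed
    -- before any sequence of codebooks enters.
    set G := g * (4 * c₂₁) ^ (-r) with hG_def
    have hG : 0 < G := by positivity
    refine ⟨lam.real (Metric.ball (0 : E) 1) * (1 + Module.finrank ℝ E / r) *
        c₂₁ ^ Module.finrank ℝ E,
      lam.real (Metric.ball (0 : E) 1) * c₂₁ ^ (r + (Module.finrank ℝ E : ℝ)), G,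
      (G / (2 * lam.real (Metric.ball (0 : E) 1))) ^ (r / (Module.finrank ℝ E : ℝ)) * (G / 2),
      by positivity, by positivity, hG, by positivity, fun α hopt hα x a ha => ?_⟩
    have hmass := fun (m : ℝ) (hm : 0 < m) (hmle : ∀ᶠ y in 𝓝[≠] x, m ≤ h y) =>
      Quantization.eventually_le_mass lam hr hc₂₁ h_moment hg hgain hopt hα ha hm hmle
    obtain ⟨L, hL⟩ := Quantization.exists_tendsto_ballSup_div_ballInf h x
    obtain ⟨l, hl⟩ := Quantization.exists_tendsto_ballInf_div_ballSup h x
    refine ⟨?_, ⟨L, hL, ?_⟩, ?_, ⟨l, hl, ?_⟩⟩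
    · refine Quantization.le_ofReal_mul_rpow_of_forall_gt (by positivity) hq fun M hM hlt => ?_
      refine Quantization.limsup_mass_le lam h_below hr hc₂₁ hα ha hM ?_
      filter_upwards [eventually_lt_of_limsup_lt hlt] with y hy
      exact ((ENNReal.ofReal_lt_ofReal_iff hM).1 hy).le
    · refine h_below.coe_le_mul_one_add_log (by positivity) hL fun ε m M hε hm hmM hbd => ?_
      exact Quantization.limsup_inertia_le lam h_meas h_below hr hc₂₁ hα ha hm hmM
        (eventually_of_mem (hball x ε hε) fun y hy => (hbd y hy).1)
        (eventually_of_mem (hball x ε hε) fun y hy => (hbd y hy).2)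
    · refine Quantization.ofReal_mul_rpow_le_of_forall_lt hG hq fun m hm hlt => ?_
      refine Quantization.le_liminf_natCast_mul (hmass m hm ?_)
      filter_upwards [eventually_lt_of_lt_liminf hlt] with y hy
      exact ((ENNReal.ofReal_lt_ofReal_iff (h_below.pos y)).1 hy).le
    · refine h_below.mul_rpow_le (q := r / (Module.finrank ℝ E : ℝ)) (by positivity)
        (by positivity) ?_ hl fun ε m M hε hm hmM hbd => ?_
      -- The argument yields the exponent r/d, which is at most r and hence at most max(1, r).
      · exact (div_le_self hr.le (by exact_mod_cast hd)).trans (le_max_right _ _)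
      · have hmle := eventually_of_mem (hball x ε hε) fun y hy => (hbd y hy).1
        exact Quantization.le_liminf_inertia lam h_meas hr hc₂₁ hα ha hG hm (hm.trans_le hmM)
          hmle (eventually_of_mem (hball x ε hε) fun y hy => (hbd y hy).2) (hmass m hm hmle)
  · have hne : (𝓝[≠] x).NeBot := Module.punctured_nhds_neBot ℝ E x
    have hlim : Tendsto (fun y => ENNReal.ofReal (h y)) (𝓝[≠] x) (𝓝 (ENNReal.ofReal (h x))) :=
      ((ENNReal.continuous_ofReal.comp hcont).tendsto x).mono_left nhdsWithin_le_nhds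
    have h0 : ENNReal.ofReal (h x) ≠ 0 := (ENNReal.ofReal_pos.2 (h_below.pos x)).ne'
    have hone : ENNReal.ofReal (h x) / ENNReal.ofReal (h x) = 1 :=
      ENNReal.div_self h0 ENNReal.ofReal_ne_top
    have hsup := Quantization.tendsto_ballSup hcont x
    have hinf := Quantization.tendsto_ballInf hcont x
    refine ⟨hlim.limsup_eq, hlim.liminf_eq, ?_, ?_⟩
    · simpa only [hone] using ENNReal.Tendsto.div hsup (Or.inl h0) hinf (Or.inl ENNReal.ofReal_ne_top)
    · simpa only [hone] using ENNReal.Tendsto.div hinf (Or.inl h0) hsup (Or.inl ENNReal.ofReal_ne_top)
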